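/- Let $S$ be a finite set and $\mu:S\times S\to\mathbb R_+$ a directed distance, i.e. $\mu(s,s)=0$ for all $s\in S$. A network $(G,S,c)$ is a finite directed graph $G=(VG,EG)$ with $S\subseteq VG$ (the elements of $S$ are called terminals) and edge capacities $c:EG\to\mathbb Z_+$. An $S$-path is a directed path joining distinct terminals. A multiflow is a set $\mathcal P$ of $S$-paths with $\lambda:\mathcal P\to\mathbb R_+$ such that $\sum\{\lambda(P): P\in\mathcal P,\ P\ni e\}\le c(e)$ for all $e\in EG$. ${\rm MFP}^*(\mu;G,S,c)$ denotes the maximum of $\sum_{P\in\mathcal P}\lambda(P)\mu(s_P,t_P)$ over all multiflows, where $P$ runs from $s_P$ to $t_P$. A node fulfills the Eulerian condition if the total capacity of the edges leaving it equals that of the edges entering it; the network is totally Eulerian if every node fulfills it. Let $S^c,S^r$ be two disjoint copies of $S$ and $S^{cr}=S^c\cup S^r$. For $X\subseteq S$ let $X^c,X^r$ be the corresponding copies, and for $p\in\mathbb R^{S^{cr}}$ let $p^c,p^r$ be its restrictions to $S^c,S^r$. Put $$P_\mu=\{p\in\mathbb R^{S^{cr}}: p(s^c)+p(t^r)\ge\mu(s,t)\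 \ (s,t\in S)\},$$ let $Q_\mu$ be the set of coordinatewise minimal elements of $P_\mu$, and put $$D_\infty(p,q)=\max\Big\{\max_{s\in S}\,(q(s^c)-p(s^c))_+,\ \max_{s\in S}\,(p(s^r)-q(s^r))_+\Big\}.$$ For $R\subseteq P_\mu$ let $R^+$ be the set of nonnegative points of $R$, and $R_s=\{p\in R: p(s^c)+p(s^r)=0\}$ for $s\in S$. ${\rm FLP}^*(R;G,S,c)$ denotes the minimum of $\sum_{xy\in EG}c(xy)D_\infty(\rho(x),\rho(y))$ over all maps $\rho:VG\to R$ with $\rho(s)\in R_s$ for all $s\in S$. For $p\in Q_\mu$ let $K(p)$ be the bipartite graph on $S^{cr}$ with edges $s^ct^r$ for $p(s^c)+p(t^r)=\mu(s,t)$, and for $U\subseteq S^{cr}$ let $N_p(U)$ be the set of nodes outside $U$ adjacent in $K(p)$ to a node of $U$. Let $\mathcal S_0$ be the family of $X\subseteq S$ with $\mu(s,t)=0$ for all $s,t\in X$. For $X\in\mathcal S_0$ let $Q_{\mu,X}$ be the set of $p\in Q_\mu$ such that, for every $s\in S$, $s^cs^r$ is an edge of $K(p)$ if and only if $s\in X$.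 A point $p\in Q_{\mu,X}$ is a fat relative to $X$ if $N_p(S^c\setminus X^c)\subseteq S^r\setminus X^r$ or $N_p(S^r\setminus X^r)\subseteq S^c\setminus X^c$. The degenerate set $Q_{\mu,X}^{deg}$ is the set of $p\in Q_{\mu,X}$ for which equality holds in at least one of these two inclusions. A fat is a point that is a fat relative to some $X\in\mathcal S_0$; a proper fat is a fat lying in no degenerate set. $Q_\mu^{slim}$ is $Q_\mu$ with all proper fats deleted. On $Q_\mu^{slim}$ let $p\sim q$ if $p-q\in(\mathbf 1,-\mathbf 1)\mathbb R$, or if for some $X\in\mathcal S_0$ both $p,q\in Q_{\mu,X}^{deg}$ and $p-q\in(\mathbf 1,-\mathbf 1)\mathbb R+(\mathbf 1_{X^c},-\mathbf 1_{X^r})\mathbb R$. A section is a subset of $Q_\mu^{slim}$ that projects bijectively onto $Q_\mu^{slim}/{\sim}$. A set $R\subseteq\mathbb R^{S^{cr}}$ is balanced if there are no two distinct points $p,q\in R$ with $p^c<q^c$ or with $p^r<q^r$, where $<$ is strict in every coordinate. A slimmed section in $(Q_\mu^{slim})^+$ is a balanced section $R\subseteq(Q_\mu^{slim})^+$ such that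 for each $X\in\mathcal S_0$ there are no two distinct points $p,q\in R\cap(Q_{\mu,X}^{deg})^+$ with $p(s^c)<q(s^c)$ for all $s\in S\setminus X$ or with $p(s^r)<q(s^r)$ for all $s\in S\setminus X$. A slimmed section in $Q_\mu^{slim}$ is a balanced section $R$ such that $R/(\mathbf 1,-\mathbf 1)\mathbb R=R'/(\mathbf 1,-\mathbf 1)\mathbb R$ for some slimmed section $R'$ in $(Q_\mu^{slim})^+$. A terminal $s$ is proper if $(Q_\mu)_s$ contains no fat, and a network is properly inner Eulerian (relative to $\mu$) if every node except the proper terminals fulfills the Eulerian condition. **Theorem.** Let $\mu$ be a directed distance on $S$. (1) ${\rm MFP}^*(\mu;G,S,c)={\rm FLP}^*(R;G,S,c)$ holds for every slimmed section $R$ in $(Q_\mu^{slim})^+$ and every properly inner Eulerian network $(G,S,c)$. (2) ${\rm MFP}^*(\mu;G,S,c)={\rm FLP}^*(R;G,S,c)$ holds for every slimmed section $R$ in $Q_\mu^{slim}$ and every totally Eulerian network $(G,S,c)$. In both cases the maximum and the minimum are attained. -/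

import Mathlib

open scoped NNReal

noncomputable section

namespace DirectedMultiflow

/-! ### Networks and multiflows -/

/-- A network `(G, S, c)`: a finite directed graph with node set `V`, terminals `S` (a subset of
the nodes, given by an injection) and nonnegative integer edge capacities. -/
structure Network (S V : Type*) where
  edges : Finset (V × V)
  terminal : S ↪ V
  cap : edges → ℕ

/-- A directed path (without repeated nodes) joining distinct terminals. -/
structure SPath {S V : Type*} (N : Network S V) where
  nodes : List V
  source : S
  target : S
  source_ne_target : source ≠ target
  head_eq : nodes.head? = some (N.terminal source)
  last_eq : nodes.getLast? = some (N.terminal target)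
  nodup : nodes.Nodup
  chain : nodes.IsChain (fun x y => (x, y) ∈ N.edges)

/-- The path contains the edge `e`: its tail and head are consecutive nodes of the path. -/
def SPath.Uses {S V : Type*} {N : Network S V} (P : SPath N) (e : V × V) : Prop :=
  [e.1, e.2] <:+: P.nodes

open Classical in
/-- A multiflow: a set of `S`-paths (there are only finitely many) with nonnegative flow values
obeying the capacities. Only the values of `flow` on `paths` matter. -/
structure Multiflow {S V : Type*} (N : Network S V) where
  paths : Finset (SPath N)
  flow : SPath N → ℝ≥0
  capacity : ∀ e : N.edges, ∑ P ∈ paths with P.Uses e.1, (flow P : ℝ) ≤ (N.cap e : ℝ)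

/-- The flow-value of a multiflow with respect to the terminal weight `μ`. -/
def Multiflow.val {S V : Type*} {N : Network S V} (f : Multiflow N) (μ : S → S → ℝ) : ℝ :=
  ∑ P ∈ f.paths, (f.flow P : ℝ) * μ P.source P.target

/-- `v` is the optimal (maximum) value of the `μ`-weighted maximum multiflow problem. -/
def IsMFPOpt {S V : Type*} (μ : S → S → ℝ) (N : Network S V) (v : ℝ) : Prop :=
  IsGreatest (Set.range fun f : Multiflow N => f.val μ) v

open Classical in
/-- The node `x` fulfills the Eulerian condition. -/
def Network.EulerianAt {S V : Type*} (N : Network S V) (x : V) : Prop :=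
  ∑ e : N.edges with e.1.1 = x, N.cap e = ∑ e : N.edges with e.1.2 = x, N.cap e

def Network.TotallyEulerian {S V : Type*} (N : Network S V) : Prop :=
  ∀ x, N.EulerianAt x

/-- A directed distance: nonnegative with zero diagonal. -/
def IsDirectedDistance {S : Type*} (μ : S → S → ℝ) : Prop :=
  (∀ s t, 0 ≤ μ s t) ∧ ∀ s, μ s s = 0

/-! ### The polyhedron, its directed metric and facility location

`S ⊕ S` is the disjoint union of the two copies `Sᶜ` (column copy, `Sum.inl`) and
`Sʳ` (row copy, `Sum.inr`) of `S`. -/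

/-- The space `ℝ^{S^{cr}}`. -/
abbrev Pt (S : Type*) := S ⊕ S → ℝ

/-- The column copy `X^c` of `X`. -/
def cCopy {S : Type*} (X : Set S) : Set (S ⊕ S) := Sum.inl '' X

/-- The row copy `X^r` of `X`. -/
def rCopy {S : Type*} (X : Set S) : Set (S ⊕ S) := Sum.inr '' X

/-- `D_∞⁺(p, q) = ‖(q - p)₊‖_∞` (for a finite index set). -/
def DinfPlus {X : Type*} (p q : X → ℝ) : ℝ := ⨆ x, max (q x - p x) 0

/-- `D_∞(p, q) = max (D_∞⁺(p^c, q^c), D_∞⁺(q^r, p^r))`. -/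
def Dinf {S : Type*} (p q : Pt S) : ℝ :=
  max (DinfPlus (fun s => p (Sum.inl s)) (fun s => q (Sum.inl s)))
    (DinfPlus (fun s => q (Sum.inr s)) (fun s => p (Sum.inr s)))

/-- The polyhedron `P_μ`. -/
def P {S : Type*} (μ : S → S → ℝ) : Set (Pt S) :=
  {p | ∀ s t, μ s t ≤ p (Sum.inl s) + p (Sum.inr t)}

/-- `R⁺`: the nonnegative points of `R`. -/
def posPart {S : Type*} (R : Set (Pt S)) : Set (Pt S) := {p ∈ R | ∀ u, 0 ≤ p u}

/-- `R_s`: the points of `R` with `p(s^c) + p(s^r) = 0`. -/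
def atTerminal {S : Type*} (R : Set (Pt S)) (s : S) : Set (Pt S) :=
  {p ∈ R | p (Sum.inl s) + p (Sum.inr s) = 0}

/-- `Q_μ`: the minimal elements of `P_μ` in the coordinatewise order. -/
def Q {S : Type*} (μ : S → S → ℝ) : Set (Pt S) := {p | Minimal (fun q => q ∈ P μ) p}

/-- The map `ρ` is feasible to the facility location problem on `R`. -/
def FLPFeasible {S V : Type*} (R : Set (Pt S)) (N : Network S V) (ρ : V → Pt S) : Prop :=
  (∀ x, ρ x ∈ R) ∧ ∀ s, ρ (N.terminal s) ∈ atTerminal R s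

/-- The objective value of the facility location problem. -/
def FLPCost {S V : Type*} (N : Network S V) (ρ : V → Pt S) : ℝ :=
  ∑ e : N.edges, (N.cap e : ℝ) * Dinf (ρ e.1.1) (ρ e.1.2)

/-- `v` is the optimal (minimum) value of the facility location problem on `R`. -/
def IsFLPOpt {S V : Type*} (R : Set (Pt S)) (N : Network S V) (v : ℝ) : Prop :=
  IsLeast {w | ∃ ρ : V → Pt S, FLPFeasible R N ρ ∧ w = FLPCost N ρ} v

/-! ### Fats, degenerate sets and the slimmed tropical polytope -/

/-- The bipartite graph `K(p)` on `S^{cr}` of tight constraints at `p`. -/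
def K {S : Type*} (μ : S → S → ℝ) (p : Pt S) : SimpleGraph (S ⊕ S) :=
  SimpleGraph.fromRel fun u v => ∃ s t, u = Sum.inl s ∧ v = Sum.inr t ∧ p u + p v = μ s t

/-- `N_p(U)`: the nodes outside `U` that are incident to `U` in `K(p)`. -/
def nbr {S : Type*} (μ : S → S → ℝ) (p : Pt S) (U : Set (S ⊕ S)) : Set (S ⊕ S) :=
  {v | v ∉ U ∧ ∃ u ∈ U, (K μ p).Adj u v}

/-- The family `𝒮₀` of sets of terminals on which `μ` vanishes. -/
def zeroSets {S : Type*} (μ : S → S → ℝ) : Set (Set S) :=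
  {X | ∀ s ∈ X, ∀ t ∈ X, μ s t = 0}

/-- `Q_{μ,X}`: the points `p` of `Q_μ` with `s^c s^r` an edge of `K(p)` exactly for `s ∈ X`. -/
def QX {S : Type*} (μ : S → S → ℝ) (X : Set S) : Set (Pt S) :=
  {p ∈ Q μ | ∀ s, (K μ p).Adj (Sum.inl s) (Sum.inr s) ↔ s ∈ X}

/-- `p` is a fat relative to `X`. -/
def IsFatRel {S : Type*} (μ : S → S → ℝ) (X : Set S) (p : Pt S) : Prop :=
  p ∈ QX μ X ∧ (nbr μ p (cCopy Xᶜ) ⊆ rCopy Xᶜ ∨ nbr μ p (rCopy Xᶜ) ⊆ cCopy Xᶜ)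

/-- The degenerate set `Q_{μ,X}^{deg}`. -/
def Qdeg {S : Type*} (μ : S → S → ℝ) (X : Set S) : Set (Pt S) :=
  {p ∈ QX μ X | nbr μ p (cCopy Xᶜ) = rCopy Xᶜ ∨ nbr μ p (rCopy Xᶜ) = cCopy Xᶜ}

def IsFat {S : Type*} (μ : S → S → ℝ) (p : Pt S) : Prop :=
  ∃ X ∈ zeroSets μ, IsFatRel μ X p

/-- A proper fat: a fat that lies in no degenerate set. -/
def IsProperFat {S : Type*} (μ : S → S → ℝ) (p : Pt S) : Prop :=
  IsFat μ p ∧ ∀ X ∈ zeroSets μ, p ∉ Qdeg μ X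

/-- `Q_μ^{slim}`: `Q_μ` with all proper fats deleted. -/
def Qslim {S : Type*} (μ : S → S → ℝ) : Set (Pt S) := {p ∈ Q μ | ¬ IsProperFat μ p}

/-- The vector `(𝟙_{X^c}, -𝟙_{X^r})`. -/
def vec {S : Type*} (X : Set S) : Pt S :=
  Sum.elim (X.indicator fun _ => 1) (X.indicator fun _ => -1)

/-- The line `(𝟙, -𝟙)ℝ`. -/
def line (S : Type*) : Submodule ℝ (Pt S) := Submodule.span ℝ {vec Set.univ}

/-- The relation `∼`. -/
def SlimRel {S : Type*} (μ : S → S → ℝ) (p q : Pt S) : Prop :=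
  p - q ∈ line S ∨
    ∃ X ∈ zeroSets μ, p ∈ Qdeg μ X ∧ q ∈ Qdeg μ X ∧
      p - q ∈ line S ⊔ Submodule.span ℝ {vec X}

lemma K_eq_of_sub_mem_line {S : Type*} (μ : S → S → ℝ) {p q : Pt S} (h : p - q ∈ line S) :
    K μ p = K μ q := by
  obtain ⟨a, ha⟩ := Submodule.mem_span_singleton.1 h
  have key : ∀ s t : S, p (Sum.inl s) + p (Sum.inr t) = q (Sum.inl s) + q (Sum.inr t) := by
    intro s t
    have h1 := congrFun ha (Sum.inl s)
    have h2 := congrFun ha (Sum.inr t)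
    simp [vec] at h1 h2
    linarith
  unfold K
  congr 1
  funext u v
  apply propext
  constructor
  · rintro ⟨s, t, rfl, rfl, h⟩
    exact ⟨s, t, rfl, rfl, by rw [← key]; exact h⟩
  · rintro ⟨s, t, rfl, rfl, h⟩
    exact ⟨s, t, rfl, rfl, by rw [key]; exact h⟩

lemma Qdeg_of_sub_mem_line {S : Type*} (μ : S → S → ℝ) {p q : Pt S} (hp : p ∈ Q μ)
    (h : p - q ∈ line S) {X : Set S} (hq : q ∈ Qdeg μ X) : p ∈ Qdeg μ X := by
  have hK := K_eq_of_sub_mem_line μ h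
  obtain ⟨⟨_, h1⟩, h2⟩ := hq
  refine ⟨⟨hp, ?_⟩, ?_⟩
  · rw [hK]
    exact h1
  · simp only [nbr, hK] at h2 ⊢
    exact h2

lemma sub_mem_symm {S : Type*} {W : Submodule ℝ (Pt S)} {p q : Pt S} (h : p - q ∈ W) :
    q - p ∈ W := by
  have := W.neg_mem h
  rwa [neg_sub] at this

lemma sub_mem_trans {S : Type*} {W : Submodule ℝ (Pt S)} {p q r : Pt S} (h : p - q ∈ W)
    (h' : q - r ∈ W) : p - r ∈ W := by
  have := W.add_mem h h'
  rwa [sub_add_sub_cancel] at this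

/-- The relation `∼` as an equivalence relation on `Q_μ^{slim}`. -/
def slimSetoid {S : Type*} (μ : S → S → ℝ) : Setoid (Qslim μ) where
  r p q := SlimRel μ p.1 q.1
  iseqv :=
    { refl := fun p => Or.inl (by simp)
      symm := by
        rintro p q (h | ⟨X, hX, hp, hq, h⟩)
        · exact Or.inl (sub_mem_symm h)
        · exact Or.inr ⟨X, hX, hq, hp, sub_mem_symm h⟩
      trans := by
        rintro ⟨p, hp⟩ ⟨q, hq⟩ ⟨r, hr⟩ (h | ⟨X, hX, hpX, hqX, h⟩) (h' | ⟨Y, hY, hqY, hrY, h'⟩)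
        · exact Or.inl (sub_mem_trans h h')
        · exact Or.inr ⟨Y, hY, Qdeg_of_sub_mem_line μ hp.1 h hqY, hrY,
            sub_mem_trans (Submodule.mem_sup_left h) h'⟩
        · exact Or.inr ⟨X, hX, hpX, Qdeg_of_sub_mem_line μ hr.1 (sub_mem_symm h') hqX,
            sub_mem_trans h (Submodule.mem_sup_left h')⟩
        · have hXY : X = Y := by
            ext s
            rw [← hqX.1.2 s, ← hqY.1.2 s]
          subst hXY
          exact Or.inr ⟨X, hX, hpX, hrY, sub_mem_trans h h'⟩ }

/-- The slimmed tropical polytope `Q_μ^{slim} / ∼`. -/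
def SlimmedTropicalPolytope {S : Type*} (μ : S → S → ℝ) : Type _ := Quotient (slimSetoid μ)

/-! ### Slimmed sections -/

/-- A section: a subset of `Q_μ^{slim}` that projects bijectively onto the slimmed tropical
polytope. -/
def IsSlimSection {S : Type*} (μ : S → S → ℝ) (R : Set (Pt S)) : Prop :=
  R ⊆ Qslim μ ∧
    Set.BijOn (fun p : Qslim μ => (Quotient.mk (slimSetoid μ) p : SlimmedTropicalPolytope μ))
      (Subtype.val ⁻¹' R) Set.univ

/-- Balanced: no two points `p, q` of `R` satisfy `p^c < q^c` or `p^r < q^r`, where `<` is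
strict in every coordinate. -/
def IsBalanced {S : Type*} (R : Set (Pt S)) : Prop :=
  ∀ p ∈ R, ∀ q ∈ R, p ≠ q →
    ¬ ((∀ s, p (Sum.inl s) < q (Sum.inl s)) ∨ ∀ s, p (Sum.inr s) < q (Sum.inr s))

/-- A slimmed section in `(Q_μ^{slim})⁺`. -/
def IsNonnegSlimmedSection {S : Type*} (μ : S → S → ℝ) (R : Set (Pt S)) : Prop :=
  R ⊆ posPart (Qslim μ) ∧ IsSlimSection μ R ∧ IsBalanced R ∧
    ∀ X ∈ zeroSets μ, ∀ p ∈ R ∩ posPart (Qdeg μ X), ∀ q ∈ R ∩ posPart (Qdeg μ X), p ≠ q →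
      ¬ ((∀ s ∉ X, p (Sum.inl s) < q (Sum.inl s)) ∨ ∀ s ∉ X, p (Sum.inr s) < q (Sum.inr s))

/-- A slimmed section in `Q_μ^{slim}`. -/
def IsSlimmedSection {S : Type*} (μ : S → S → ℝ) (R : Set (Pt S)) : Prop :=
  IsSlimSection μ R ∧ IsBalanced R ∧
    ∃ R', IsNonnegSlimmedSection μ R' ∧ (line S).mkQ '' R = (line S).mkQ '' R'

/-- A terminal `s` is proper if `(Q_μ)_s` has no fat. -/
def IsProperTerminal {S : Type*} (μ : S → S → ℝ) (s : S) : Prop :=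
  ∀ p ∈ atTerminal (Q μ) s, ¬ IsFat μ p

/-- Every node except proper terminals fulfills the Eulerian condition. -/
def Network.ProperlyInnerEulerian {S V : Type*} (N : Network S V) (μ : S → S → ℝ) : Prop :=
  ∀ x, (¬ ∃ s, N.terminal s = x ∧ IsProperTerminal μ s) → N.EulerianAt x

end DirectedMultiflow

end

namespace DirectedMultiflow

open Finset

/-! The value of a multiflow is bounded by the cost of every feasible location: along an `S`-path
from s to t the coordinate s^c is a potential that rises from 0 to at least μ(s,t)
(`isMFPOpt_le_FLPCost`). For the converse, linear programming duality (`exists_isMFPOpt`) gives edge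
lengths w, of total cost the flow optimum, for which every `S`-path has length at least μ. The
distances from and to the terminals then form a nonnegative location in `P μ` (`exists_location`).
It remains to push this location into the section R without raising its cost.

The push is done with the signed distance `D0`. Translating points along (𝟙, -𝟙) changes `D0` by the
difference of the two shifts, so the cost is unchanged as long as only Eulerian nodes are shifted
(`cost0_translate`). In a balanced set `D0` and `Dinf` agree (`Dinf_eq_D0`), so the signed cost is
the true cost once the location lies in R.

Among nonnegative locations of no larger cost, take one with the least sum of coordinates. It lies
in `Q μ`, since otherwise `contract` would lower the sum. It contains no proper fat, since otherwise
moving fats of one closed type simultaneously would lower the sum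
(`exists_improvement_of_isProperFat`). Both operations keep `D0` from growing; any loss of
nonnegativity is repaired by translations. Proper terminals carry no fats and need no translation,
which is why the Eulerian condition is not needed there (`exists_slim_location`). Finally each point
is replaced by its representative in R. Balance and slimness bound each signed distance by its old
value plus a difference of shifts (`Represents.D0_le`), and these differences cancel over the
network. -/

/-- The inequality of `P μ` for the pair `(s, t)` is tight at `p`. -/
def Tight {S : Type*} (μ : S → S → ℝ) (p : Pt S) (s t : S) : Prop :=
  p (Sum.inl s) + p (Sum.inr t) = μ s t

/-- The set of terminals `s` with `p ∈ atTerminal _ s`. -/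
def zeroSet {S : Type*} (p : Pt S) : Set S := {s | p (Sum.inl s) + p (Sum.inr s) = 0}

/-- The smallest column part that is feasible together with the row part `r`. -/
noncomputable def colStar {S : Type*} (μ : S → S → ℝ) (r : S → ℝ) (s : S) : ℝ := ⨆ t, (μ s t - r t)

/-- The smallest row part that is feasible together with the column part `c`. -/
noncomputable def rowStar {S : Type*} (μ : S → S → ℝ) (c : S → ℝ) (t : S) : ℝ := ⨆ s, (μ s t - c s)

/-- The signed version of `Dinf`, without truncation at zero. -/
noncomputable def D0 {S : Type*} (p q : Pt S) : ℝ :=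
  ⨆ u : S ⊕ S, Sum.elim (fun s => q (Sum.inl s) - p (Sum.inl s))
    (fun s => p (Sum.inr s) - q (Sum.inr s)) u

/-! ### Finite suprema, the signed distance and its truncation -/

section Finite

variable {S : Type*} [Finite S]

lemma le_ciSup_finite {ι : Type*} [Finite ι] (f : ι → ℝ) (i : ι) : f i ≤ ⨆ j, f j :=
  le_ciSup (Set.finite_range f).bddAbove i

lemma sub_le_colStar (μ : S → S → ℝ) (r : S → ℝ) (s t : S) : μ s t - r t ≤ colStar μ r s :=
  le_ciSup_finite (fun t => μ s t - r t) t

lemma sub_le_rowStar (μ : S → S → ℝ) (c : S → ℝ) (s t : S) : μ s t - c s ≤ rowStar μ c t :=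
  le_ciSup_finite (fun s => μ s t - c s) s

lemma exists_colStar_eq [Nonempty S] (μ : S → S → ℝ) (r : S → ℝ) (s : S) :
    ∃ t, μ s t - r t = colStar μ r s :=
  exists_eq_ciSup_of_finite (f := fun t => μ s t - r t)

lemma exists_rowStar_eq [Nonempty S] (μ : S → S → ℝ) (c : S → ℝ) (t : S) :
    ∃ s, μ s t - c s = rowStar μ c t :=
  exists_eq_ciSup_of_finite (f := fun s => μ s t - c s)

lemma sub_inl_le_D0 (p q : Pt S) (s : S) : q (Sum.inl s) - p (Sum.inl s) ≤ D0 p q :=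
  le_ciSup_finite (Sum.elim (fun s => q (Sum.inl s) - p (Sum.inl s))
    (fun s => p (Sum.inr s) - q (Sum.inr s))) (Sum.inl s)

lemma sub_inr_le_D0 (p q : Pt S) (s : S) : p (Sum.inr s) - q (Sum.inr s) ≤ D0 p q :=
  le_ciSup_finite (Sum.elim (fun s => q (Sum.inl s) - p (Sum.inl s))
    (fun s => p (Sum.inr s) - q (Sum.inr s))) (Sum.inr s)

omit [Finite S] in
lemma D0_le [Nonempty S] {p q : Pt S} {d : ℝ} (hc : ∀ s, q (Sum.inl s) - p (Sum.inl s) ≤ d)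
    (hr : ∀ s, p (Sum.inr s) - q (Sum.inr s) ≤ d) : D0 p q ≤ d :=
  ciSup_le (by rintro (s | s); exacts [hc s, hr s])

lemma continuous_D0 [Nonempty S] : Continuous fun a : Pt S × Pt S => D0 a.1 a.2 := by
  have := Fintype.ofFinite S
  have h : (fun a : Pt S × Pt S => D0 a.1 a.2) = fun a => univ.sup' univ_nonempty
      (fun u : S ⊕ S => Sum.elim (fun s => a.2 (Sum.inl s) - a.1 (Sum.inl s))
        (fun s => a.1 (Sum.inr s) - a.2 (Sum.inr s)) u) := by
    funext a
    rw [sup'_univ_eq_ciSup]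
    rfl
  rw [h]
  refine Continuous.finset_sup'_apply _ ?_
  rintro (s | s) - <;> simp only [Sum.elim_inl, Sum.elim_inr] <;> fun_prop

lemma sub_inl_le_Dinf (p q : Pt S) (s : S) : q (Sum.inl s) - p (Sum.inl s) ≤ Dinf p q :=
  (le_max_left _ 0).trans ((le_ciSup_finite (fun s => max (q (Sum.inl s) - p (Sum.inl s)) 0) s).trans
    (le_max_left _ _))

lemma sub_inr_le_Dinf (p q : Pt S) (s : S) : p (Sum.inr s) - q (Sum.inr s) ≤ Dinf p q :=
  (le_max_left _ 0).trans ((le_ciSup_finite (fun s => max (p (Sum.inr s) - q (Sum.inr s)) 0) s).trans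
    (le_max_right _ _))

omit [Finite S] in
lemma Dinf_nonneg (p q : Pt S) : 0 ≤ Dinf p q :=
  le_max_of_le_left (Real.iSup_nonneg fun _ => le_max_right _ _)

omit [Finite S] in
lemma Dinf_le [Nonempty S] {p q : Pt S} {d : ℝ} (h0 : 0 ≤ d)
    (hc : ∀ s, q (Sum.inl s) - p (Sum.inl s) ≤ d)
    (hr : ∀ s, p (Sum.inr s) - q (Sum.inr s) ≤ d) : Dinf p q ≤ d :=
  max_le (ciSup_le fun s => max_le (hc s) h0) (ciSup_le fun s => max_le (hr s) h0)

lemma D0_le_Dinf [Nonempty S] (p q : Pt S) : D0 p q ≤ Dinf p q :=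
  D0_le (sub_inl_le_Dinf p q) (sub_inr_le_Dinf p q)

/-- Truncation matters only if all the signed differences are negative, and balance provides a
column coordinate in which q is at least p. -/
lemma Dinf_eq_D0 [Nonempty S] {R : Set (Pt S)} (hR : IsBalanced R) {p q : Pt S} (hp : p ∈ R)
    (hq : q ∈ R) : Dinf p q = D0 p q := by
  refine le_antisymm (Dinf_le ?_ (sub_inl_le_D0 p q) (sub_inr_le_D0 p q)) (D0_le_Dinf p q)
  by_cases h : q = p
  · subst h
    obtain ⟨s⟩ := ‹Nonempty S›
    simpa using sub_inl_le_D0 q q s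
  · have := hR q hq p hp h
    push Not at this
    obtain ⟨⟨s, hs⟩, -⟩ := this
    linarith [sub_inl_le_D0 p q s]

/-! ### The minimal points -/

/-- A coordinate without a tight partner could be lowered by itself; conversely a tight partner
blocks any decrease. -/
lemma mem_Q_iff [Nonempty S] {μ : S → S → ℝ} {p : Pt S} :
    p ∈ Q μ ↔ p ∈ P μ ∧ (∀ s, ∃ t, Tight μ p s t) ∧ ∀ t, ∃ s, Tight μ p s t := by
  classical
  constructor
  · intro hp
    refine ⟨hp.1, fun s => ?_, fun t => ?_⟩
    · obtain ⟨t, ht⟩ := exists_colStar_eq μ (fun t => p (Sum.inr t)) s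
      have hle : colStar μ (fun t => p (Sum.inr t)) s ≤ p (Sum.inl s) := by
        have := hp.1 s t
        linarith
      have hmem : Function.update p (Sum.inl s) (colStar μ (fun t => p (Sum.inr t)) s) ∈ P μ := by
        intro a b
        by_cases h : a = s
        · subst h
          have := sub_le_colStar μ (fun t => p (Sum.inr t)) a b
          simp
          linarith
        · simpa [Function.update_of_ne, h] using hp.1 a b
      have := hp.2 hmem (by rw [update_le_self_iff]; exact hle) (Sum.inl s)
      simp only [Function.update_self] at this
      exact ⟨t, by unfold Tight; linarith⟩
    · obtain ⟨s, hs⟩ := exists_rowStar_eq μ (fun s => p (Sum.inl s)) t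
      have hle : rowStar μ (fun s => p (Sum.inl s)) t ≤ p (Sum.inr t) := by
        have := hp.1 s t
        linarith
      have hmem : Function.update p (Sum.inr t) (rowStar μ (fun s => p (Sum.inl s)) t) ∈ P μ := by
        intro a b
        by_cases h : b = t
        · subst h
          have := sub_le_rowStar μ (fun s => p (Sum.inl s)) a b
          simp
          linarith
        · simpa [Function.update_of_ne, h] using hp.1 a b
      have := hp.2 hmem (by rw [update_le_self_iff]; exact hle) (Sum.inr t)
      simp only [Function.update_self] at this
      exact ⟨s, by unfold Tight; linarith⟩
  · rintro ⟨hp, hc, hr⟩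
    refine ⟨hp, fun q hq hqp u => ?_⟩
    rcases u with s | t
    · obtain ⟨t, ht⟩ := hc s
      have := hq s t
      have := hqp (Sum.inr t)
      unfold Tight at ht
      linarith
    · obtain ⟨s, hs⟩ := hr t
      have := hq s t
      have := hqp (Sum.inl s)
      unfold Tight at hs
      linarith

/-- At a minimal second point the row part determines the signed distance. -/
lemma D0_le_of_inr [Nonempty S] {μ : S → S → ℝ} {p q : Pt S} (hp : p ∈ P μ) (hq : q ∈ Q μ) {d : ℝ}
    (hr : ∀ s, p (Sum.inr s) - q (Sum.inr s) ≤ d) : D0 p q ≤ d := by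
  refine D0_le (fun s => ?_) hr
  obtain ⟨t, ht⟩ := (mem_Q_iff.1 hq).2.1 s
  have := hp s t
  have := hr t
  unfold Tight at ht
  linarith

/-- At a minimal first point the column part determines the signed distance. -/
lemma D0_le_of_inl [Nonempty S] {μ : S → S → ℝ} {p q : Pt S} (hp : p ∈ Q μ) (hq : q ∈ P μ) {d : ℝ}
    (hc : ∀ s, q (Sum.inl s) - p (Sum.inl s) ≤ d) : D0 p q ≤ d := by
  refine D0_le hc fun t => ?_
  obtain ⟨s, hs⟩ := (mem_Q_iff.1 hp).2.2 t
  have := hq s t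
  have := hc s
  unfold Tight at hs
  linarith

/-! ### A nonexpansive contraction whose fixed points in `P μ` are minimal -/

/-- The average of `p` and the smallest points compatible with its two parts. -/
noncomputable def contract (μ : S → S → ℝ) (p : Pt S) : Pt S :=
  Sum.elim (fun s => (p (Sum.inl s) + colStar μ (fun t => p (Sum.inr t)) s) / 2)
    (fun t => (p (Sum.inr t) + rowStar μ (fun s => p (Sum.inl s)) t) / 2)

/-- Each part is feasible with the minimal completion of the other, and averaging these two
inequalities gives the claim. Replacing both parts outright could leave `P μ`. -/
lemma contract_mem_P (μ : S → S → ℝ) (p : Pt S) : contract μ p ∈ P μ := by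
  intro s t
  have h1 := sub_le_colStar μ (fun t => p (Sum.inr t)) s t
  have h2 := sub_le_rowStar μ (fun s => p (Sum.inl s)) s t
  simp only [contract, Sum.elim_inl, Sum.elim_inr]
  linarith

lemma contract_le [Nonempty S] {μ : S → S → ℝ} {p : Pt S} (hp : p ∈ P μ) : contract μ p ≤ p := by
  rintro (s | t) <;> simp only [contract, Sum.elim_inl, Sum.elim_inr]
  · obtain ⟨t, ht⟩ := exists_colStar_eq μ (fun t => p (Sum.inr t)) s
    have := hp s t
    linarith
  · obtain ⟨s, hs⟩ := exists_rowStar_eq μ (fun s => p (Sum.inl s)) t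
    have := hp s t
    linarith

lemma mem_Q_of_contract_eq [Nonempty S] {μ : S → S → ℝ} {p : Pt S} (h : contract μ p = p) :
    p ∈ Q μ := by
  refine mem_Q_iff.2 ⟨h ▸ contract_mem_P μ p, fun s => ?_, fun t => ?_⟩
  · obtain ⟨t, ht⟩ := exists_colStar_eq μ (fun t => p (Sum.inr t)) s
    have := congrFun h (Sum.inl s)
    simp only [contract, Sum.elim_inl] at this
    exact ⟨t, by unfold Tight; linarith⟩
  · obtain ⟨s, hs⟩ := exists_rowStar_eq μ (fun s => p (Sum.inl s)) t
    have := congrFun h (Sum.inr t)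
    simp only [contract, Sum.elim_inr] at this
    exact ⟨s, by unfold Tight; linarith⟩

/-- `colStar` and `rowStar` are order reversing and nonexpansive, and `D0` measures the two parts in
opposite directions; so both averaged terms are bounded by `D0 p q`. -/
lemma D0_contract_le [Nonempty S] (μ : S → S → ℝ) (p q : Pt S) :
    D0 (contract μ p) (contract μ q) ≤ D0 p q := by
  refine D0_le (fun s => ?_) (fun t => ?_) <;>
    simp only [contract, Sum.elim_inl, Sum.elim_inr]
  · obtain ⟨t, ht⟩ := exists_colStar_eq μ (fun t => q (Sum.inr t)) s
    have := sub_le_colStar μ (fun t => p (Sum.inr t)) s t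
    have := sub_inr_le_D0 p q t
    have := sub_inl_le_D0 p q s
    linarith
  · obtain ⟨s, hs⟩ := exists_rowStar_eq μ (fun s => p (Sum.inl s)) t
    have := sub_le_rowStar μ (fun s => q (Sum.inl s)) s t
    have := sub_inr_le_D0 p q t
    have := sub_inl_le_D0 p q s
    linarith

end Finite

/-! ### Translations -/

/-- Translation along `(𝟙, -𝟙)`. -/
def translate {S : Type*} (p : Pt S) (h : ℝ) : Pt S :=
  Sum.elim (fun s => p (Sum.inl s) + h) (fun s => p (Sum.inr s) - h)

section translate

variable {S : Type*}

@[simp] lemma translate_inl (p : Pt S) (h : ℝ) (s : S) :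
    translate p h (Sum.inl s) = p (Sum.inl s) + h := rfl

@[simp] lemma translate_inr (p : Pt S) (h : ℝ) (s : S) :
    translate p h (Sum.inr s) = p (Sum.inr s) - h := rfl

@[simp] lemma translate_zero (p : Pt S) : translate p 0 = p := by
  funext u
  rcases u with s | s <;> simp

lemma translate_mem_P {μ : S → S → ℝ} {p : Pt S} (hp : p ∈ P μ) (h : ℝ) :
    translate p h ∈ P μ := by
  intro s t
  have := hp s t
  simp
  linarith

/-- This exact shift is the reason for working with `D0`; truncation at zero destroys it. -/
lemma D0_translate [Finite S] [Nonempty S] (p q : Pt S) (h k : ℝ) :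
    D0 (translate p h) (translate q k) = D0 p q + k - h := by
  refine le_antisymm (D0_le (fun s => ?_) (fun s => ?_)) ?_
  · have := sub_inl_le_D0 p q s
    simp
    linarith
  · have := sub_inr_le_D0 p q s
    simp
    linarith
  · have : D0 p q ≤ D0 (translate p h) (translate q k) + h - k := by
      refine D0_le (fun s => ?_) (fun s => ?_)
      · have := sub_inl_le_D0 (translate p h) (translate q k) s
        simp at this
        linarith
      · have := sub_inr_le_D0 (translate p h) (translate q k) s
        simp at this
        linarith
    linarith

lemma sum_translate [Fintype S] (p : Pt S) (h : ℝ) : ∑ u, translate p h u = ∑ u, p u := by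
  simp [Fintype.sum_sum_type, Finset.sum_add_distrib, Finset.sum_sub_distrib]

lemma sub_mem_line_iff {p q : Pt S} : p - q ∈ line S ↔ ∃ h : ℝ, p = translate q h := by
  rw [line, Submodule.mem_span_singleton]
  refine exists_congr fun a => ⟨fun h => ?_, fun h => ?_⟩
  · funext u
    have := congrFun h u
    rcases u with s | s <;> simp [vec] at this ⊢ <;> linarith
  · subst h
    funext u
    rcases u with s | s <;> simp [vec]

/-- The translation taking the smallest column coordinate to zero. -/
noncomputable def normalize (p : Pt S) : Pt S := translate p (-⨅ s, p (Sum.inl s))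

/-- For the rows, use the inequality of `P μ` at a column where the minimum, now zero, is attained.
-/
lemma normalize_nonneg [Finite S] [Nonempty S] {μ : S → S → ℝ} (hμ : IsDirectedDistance μ) {p : Pt S}
    (hp : p ∈ P μ) (u : S ⊕ S) : 0 ≤ normalize p u := by
  rcases u with s | s
  · have := ciInf_le (Set.finite_range fun s => p (Sum.inl s)).bddBelow s
    simp [normalize]
    linarith
  · obtain ⟨t, ht⟩ := exists_eq_ciInf_of_finite (f := fun s => p (Sum.inl s))
    have := hp t s
    have := hμ.1 t s
    simp [normalize]
    linarith

lemma iInf_inl_eq_zero [Finite S] {p : Pt S} (hp : ∀ s, 0 ≤ p (Sum.inl s)) {s : S}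
    (hs : p (Sum.inl s) = 0) : ⨅ s, p (Sum.inl s) = 0 := by
  have : Nonempty S := ⟨s⟩
  refine le_antisymm ?_ (le_ciInf hp)
  exact (ciInf_le (Set.finite_range fun s => p (Sum.inl s)).bddBelow s).trans hs.le

end translate

/-! ### Fats -/

section Fats

variable {S : Type*}

/-- In `K(p)`, the column copy of `zeroSet p` is joined only to the row copy of `zeroSet p`. -/
def ColClosed (μ : S → S → ℝ) (p : Pt S) : Prop :=
  ∀ s ∈ zeroSet p, ∀ t, Tight μ p s t → t ∈ zeroSet p

/-- In `K(p)`, the row copy of `zeroSet p` is joined only to the column copy of `zeroSet p`. -/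
def RowClosed (μ : S → S → ℝ) (p : Pt S) : Prop :=
  ∀ t ∈ zeroSet p, ∀ s, Tight μ p s t → s ∈ zeroSet p

/-- Each column node outside `zeroSet p` is joined to a row node outside `zeroSet p`. -/
def ColCovered (μ : S → S → ℝ) (p : Pt S) : Prop :=
  ∀ s ∉ zeroSet p, ∃ t ∉ zeroSet p, Tight μ p s t

/-- Each row node outside `zeroSet p` is joined to a column node outside `zeroSet p`. -/
def RowCovered (μ : S → S → ℝ) (p : Pt S) : Prop :=
  ∀ t ∉ zeroSet p, ∃ s ∉ zeroSet p, Tight μ p s t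

lemma K_adj_inl_inr {μ : S → S → ℝ} {p : Pt S} {s t : S} :
    (K μ p).Adj (Sum.inl s) (Sum.inr t) ↔ Tight μ p s t := by
  simp [K, Tight]

lemma K_adj_inr_inl {μ : S → S → ℝ} {p : Pt S} {s t : S} :
    (K μ p).Adj (Sum.inr t) (Sum.inl s) ↔ Tight μ p s t := by
  rw [SimpleGraph.adj_comm, K_adj_inl_inr]

lemma not_K_adj_inl_inl {μ : S → S → ℝ} {p : Pt S} {s t : S} :
    ¬ (K μ p).Adj (Sum.inl s) (Sum.inl t) := by
  simp [K]

lemma not_K_adj_inr_inr {μ : S → S → ℝ} {p : Pt S} {s t : S} :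
    ¬ (K μ p).Adj (Sum.inr s) (Sum.inr t) := by
  simp [K]

lemma nbr_cCopy (μ : S → S → ℝ) (p : Pt S) (Y : Set S) :
    nbr μ p (cCopy Y) = rCopy {t | ∃ s ∈ Y, Tight μ p s t} := by
  ext u
  rcases u with s | t
  · simp [nbr, cCopy, rCopy, not_K_adj_inl_inl]
  · simp [nbr, cCopy, rCopy, K_adj_inl_inr]

lemma nbr_rCopy (μ : S → S → ℝ) (p : Pt S) (Y : Set S) :
    nbr μ p (rCopy Y) = cCopy {s | ∃ t ∈ Y, Tight μ p s t} := by
  ext u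
  rcases u with s | t
  · simp [nbr, cCopy, rCopy, K_adj_inr_inl]
  · simp [nbr, cCopy, rCopy, not_K_adj_inr_inr]

/-- As μ vanishes on the diagonal, X is determined by p, so all notions relative to X can be
expressed through `zeroSet p`. -/
lemma mem_QX_iff {μ : S → S → ℝ} (hμ : IsDirectedDistance μ) {p : Pt S} {X : Set S} :
    p ∈ QX μ X ↔ p ∈ Q μ ∧ X = zeroSet p := by
  refine and_congr_right fun _ => ?_
  simp only [K_adj_inl_inr, Tight, hμ.2, Set.ext_iff, zeroSet, Set.mem_ofPred_eq]
  exact forall_congr' fun _ => Iff.comm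

lemma isFatRel_iff {μ : S → S → ℝ} (hμ : IsDirectedDistance μ) {p : Pt S} {X : Set S} :
    IsFatRel μ X p ↔ p ∈ Q μ ∧ X = zeroSet p ∧ (ColClosed μ p ∨ RowClosed μ p) := by
  rw [IsFatRel, mem_QX_iff hμ, and_assoc]
  refine and_congr_right fun _ => and_congr_right ?_
  rintro rfl
  rw [nbr_cCopy, nbr_rCopy, rCopy, rCopy, cCopy, cCopy,
    Set.image_subset_image_iff Sum.inr_injective, Set.image_subset_image_iff Sum.inl_injective,
    or_comm]
  refine or_congr ?_ ?_
  · refine ⟨fun h s hs t ht => ?_, fun h s => ?_⟩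
    · by_contra hn
      exact h ⟨t, hn, ht⟩ hs
    · rintro ⟨t, htn, ht⟩ hs
      exact htn (h s hs t ht)
  · refine ⟨fun h t ht s hs => ?_, fun h t => ?_⟩
    · by_contra hn
      exact h ⟨s, hn, hs⟩ ht
    · rintro ⟨s, hsn, hs⟩ ht
      exact hsn (h t ht s hs)

/-- In each equality of neighbourhoods, one inclusion is closedness (by contraposition) and the
other is covering. The neighbours of the outside columns yield the row conditions, hence the
exchange of the alternatives. -/
lemma mem_Qdeg_iff {μ : S → S → ℝ} (hμ : IsDirectedDistance μ) {p : Pt S} {X : Set S} :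
    p ∈ Qdeg μ X ↔ p ∈ Q μ ∧ X = zeroSet p ∧
      ((ColClosed μ p ∧ ColCovered μ p) ∨ (RowClosed μ p ∧ RowCovered μ p)) := by
  rw [Qdeg, Set.mem_ofPred_eq, mem_QX_iff hμ, and_assoc]
  refine and_congr_right fun _ => and_congr_right ?_
  rintro rfl
  rw [nbr_cCopy, nbr_rCopy, rCopy, rCopy, cCopy, cCopy,
    Set.image_eq_image Sum.inr_injective, Set.image_eq_image Sum.inl_injective, or_comm,
    Set.Subset.antisymm_iff, Set.Subset.antisymm_iff]
  refine or_congr (and_congr ?_ Iff.rfl) (and_congr ?_ Iff.rfl)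
  · refine ⟨fun h s hs t ht => ?_, fun h s => ?_⟩
    · by_contra hn
      exact h ⟨t, hn, ht⟩ hs
    · rintro ⟨t, htn, ht⟩ hs
      exact htn (h s hs t ht)
  · refine ⟨fun h t ht s hs => ?_, fun h t => ?_⟩
    · by_contra hn
      exact h ⟨s, hn, hs⟩ ht
    · rintro ⟨s, hsn, hs⟩ ht
      exact hsn (h t ht s hs)

/-- The left sides of the inequalities for (s,t) and (t,s) are nonnegative and add up to zero, so
both vanish. -/
lemma inl_eq_of_mem_zeroSet {μ : S → S → ℝ} (hμ : IsDirectedDistance μ) {p : Pt S} (hp : p ∈ P μ)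
    {s t : S} (hs : s ∈ zeroSet p) (ht : t ∈ zeroSet p) : p (Sum.inl s) = p (Sum.inl t) := by
  have h1 := hp s t
  have h2 := hp t s
  have h3 := hμ.1 s t
  have h4 := hμ.1 t s
  simp only [zeroSet, Set.mem_ofPred_eq] at hs ht
  linarith

lemma inl_add_inr_of_mem_zeroSet {μ : S → S → ℝ} (hμ : IsDirectedDistance μ) {p : Pt S}
    (hp : p ∈ P μ) {s t : S} (hs : s ∈ zeroSet p) (ht : t ∈ zeroSet p) :
    p (Sum.inl s) + p (Sum.inr t) = 0 := by
  rw [inl_eq_of_mem_zeroSet hμ hp hs ht]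
  exact ht

lemma zeroSet_mem_zeroSets {μ : S → S → ℝ} (hμ : IsDirectedDistance μ) {p : Pt S} (hp : p ∈ P μ) :
    zeroSet p ∈ zeroSets μ := fun s hs t ht =>
  le_antisymm ((hp s t).trans (inl_add_inr_of_mem_zeroSet hμ hp hs ht).le) (hμ.1 s t)

lemma isFat_iff {μ : S → S → ℝ} (hμ : IsDirectedDistance μ) {p : Pt S} :
    IsFat μ p ↔ p ∈ Q μ ∧ (ColClosed μ p ∨ RowClosed μ p) := by
  simp only [IsFat, isFatRel_iff hμ]
  constructor
  · rintro ⟨X, -, h1, -, h2⟩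
    exact ⟨h1, h2⟩
  · rintro ⟨h1, h2⟩
    exact ⟨_, zeroSet_mem_zeroSets hμ h1.1, h1, rfl, h2⟩

/-- A fat surviving in `Qslim μ` is degenerate, and its zero set leaves only one candidate for X. -/
lemma mem_Qdeg_of_isFat {μ : S → S → ℝ} (hμ : IsDirectedDistance μ) {p : Pt S} (hp : p ∈ Qslim μ)
    (h : ColClosed μ p ∨ RowClosed μ p) : p ∈ Qdeg μ (zeroSet p) := by
  by_contra hn
  refine hp.2 ⟨(isFat_iff hμ).2 ⟨hp.1, h⟩, fun X _ hX => ?_⟩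
  have := ((mem_Qdeg_iff hμ).1 hX).2.1
  subst this
  exact hn hX

/-! ### Reversal -/

/-- Exchange the row and the column copy. -/
def swapPt (p : Pt S) : Pt S := fun u => p u.swap

@[simp] lemma swapPt_inl (p : Pt S) (s : S) : swapPt p (Sum.inl s) = p (Sum.inr s) := rfl

@[simp] lemma swapPt_inr (p : Pt S) (s : S) : swapPt p (Sum.inr s) = p (Sum.inl s) := rfl

@[simp] lemma swapPt_swapPt (p : Pt S) : swapPt (swapPt p) = p := by
  funext u
  simp [swapPt]

lemma isDirectedDistance_swap {μ : S → S → ℝ} (hμ : IsDirectedDistance μ) :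
    IsDirectedDistance (Function.swap μ) := ⟨fun s t => hμ.1 t s, hμ.2⟩

lemma swapPt_mem_P {μ : S → S → ℝ} {p : Pt S} (hp : p ∈ P μ) : swapPt p ∈ P (Function.swap μ) :=
  fun s t => by
    have := hp t s
    simp [Function.swap]
    linarith

lemma tight_swapPt {μ : S → S → ℝ} {p : Pt S} {s t : S} :
    Tight (Function.swap μ) (swapPt p) s t ↔ Tight μ p t s := by
  simp [Tight, Function.swap, add_comm]

@[simp] lemma zeroSet_swapPt (p : Pt S) : zeroSet (swapPt p) = zeroSet p := by
  simp [zeroSet, add_comm]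

lemma swapPt_mem_Q [Finite S] [Nonempty S] {μ : S → S → ℝ} {p : Pt S} (hp : p ∈ Q μ) :
    swapPt p ∈ Q (Function.swap μ) := by
  rw [mem_Q_iff] at hp ⊢
  simp only [tight_swapPt]
  exact ⟨swapPt_mem_P hp.1, hp.2.2, hp.2.1⟩

lemma D0_swapPt (p q : Pt S) : D0 (swapPt q) (swapPt p) = D0 p q := by
  unfold D0
  rw [← (Equiv.sumComm S S).iSup_comp]
  congr 1
  funext u
  rcases u with s | s <;> simp

lemma sum_swapPt [Fintype S] (p : Pt S) : ∑ u, swapPt p u = ∑ u, p u := by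
  simp [Fintype.sum_sum_type, add_comm]

lemma colClosed_swapPt {μ : S → S → ℝ} {p : Pt S} :
    ColClosed (Function.swap μ) (swapPt p) ↔ RowClosed μ p := by
  simp [ColClosed, RowClosed, tight_swapPt]

lemma colCovered_swapPt {μ : S → S → ℝ} {p : Pt S} :
    ColCovered (Function.swap μ) (swapPt p) ↔ RowCovered μ p := by
  simp [ColCovered, RowCovered, tight_swapPt]

/-! ### Coordinates in the zero set dominating the others -/

/-- Let Z be the zero set of p. Since p^r is constant on Z, the x in Z minimizing q(x^r) maximizes
p^r - q^r there. A q-tight edge from y in Z to t outside Z would give p(x^r) - q(x^r) ≤ q(y^c) -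
p(y^c) ≤ p(t^r) - q(t^r) ≤ d. So q-tight edges from Z stay in Z, where μ vanishes; they must end at
minimizers, which forces q^c = -q(x^r) on Z and puts their ends into the zero set of q. -/
lemma zeroSet_of_inr_exceeds [Finite S] [Nonempty S] {μ : S → S → ℝ} (hμ : IsDirectedDistance μ)
    {p q : Pt S} (hp : p ∈ P μ) (hq : q ∈ Q μ) {d : ℝ}
    (hout : ∀ t ∉ zeroSet p, p (Sum.inr t) - q (Sum.inr t) ≤ d) {x₀ : S} (hx₀ : x₀ ∈ zeroSet p)
    (hd : d < p (Sum.inr x₀) - q (Sum.inr x₀)) :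
    (∃ x ∈ zeroSet q, x ∈ zeroSet p ∧ ∀ y ∈ zeroSet p, q (Sum.inr x) ≤ q (Sum.inr y)) ∧
      zeroSet q ⊆ zeroSet p ∧ ∀ x ∈ zeroSet p, ∀ t, Tight μ q x t → t ∈ zeroSet q := by
  obtain ⟨x, hx, hmin⟩ := (zeroSet p).toFinite.exists_minimalFor (fun x => q (Sum.inr x)) _ ⟨x₀, hx₀⟩
  replace hmin : ∀ y ∈ zeroSet p, q (Sum.inr x) ≤ q (Sum.inr y) := fun y hy =>
    (le_total (q (Sum.inr x)) (q (Sum.inr y))).elim id fun h => hmin hy h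
  have hxx₀ : p (Sum.inr x) = p (Sum.inr x₀) := by
    have := inl_eq_of_mem_zeroSet hμ hp hx hx₀
    simp only [zeroSet, Set.mem_ofPred_eq] at hx hx₀
    linarith
  have hin : ∀ y ∈ zeroSet p, ∀ t, Tight μ q y t → t ∈ zeroSet p := by
    intro y hy t ht
    by_contra hn
    have h1 := hout t hn
    have h2 := hp y t
    have h3 := hq.1 y x
    have h4 := hμ.1 y x
    have h5 := hmin x₀ hx₀
    have h6 := inl_add_inr_of_mem_zeroSet hμ hp hy hx
    unfold Tight at ht
    linarith
  have hval : ∀ y ∈ zeroSet p, ∀ t, Tight μ q y t →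
      q (Sum.inr t) = q (Sum.inr x) ∧ q (Sum.inl y) = - q (Sum.inr x) := by
    intro y hy t ht
    have h1 := hin y hy t ht
    have h2 := zeroSet_mem_zeroSets hμ hp y hy t h1
    have h3 := hmin t h1
    have h4 := hq.1 y x
    have h5 := hμ.1 y x
    unfold Tight at ht
    constructor <;> linarith
  have hcol : ∀ y ∈ zeroSet p, q (Sum.inl y) = - q (Sum.inr x) := fun y hy => by
    obtain ⟨t, ht⟩ := (mem_Q_iff.1 hq).2.1 y
    exact (hval y hy t ht).2
  have hxq : x ∈ zeroSet q := by
    simp [zeroSet, hcol x hx]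
  refine ⟨⟨x, hxq, hx, hmin⟩, fun t ht => hin x hx t ?_, fun y hy t ht => ?_⟩
  · rw [Tight, inl_add_inr_of_mem_zeroSet hμ hq.1 hxq ht, zeroSet_mem_zeroSets hμ hq.1 x hxq t ht]
  · simp [zeroSet, (hval y hy t ht).1, hcol t (hin y hy t ht)]

/-- Signed distances from a point to a point of `Qslim` with another zero set that is
degenerate (or no fat at all) are attained outside the zero set. -/
lemma sub_inr_le_of_notMem_Qdeg [Finite S] [Nonempty S] {μ : S → S → ℝ} (hμ : IsDirectedDistance μ)
    {p q : Pt S} (hp : p ∈ P μ) (hq : q ∈ Qslim μ) (hn : q ∉ Qdeg μ (zeroSet p)) {d : ℝ}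
    (hout : ∀ t ∉ zeroSet p, p (Sum.inr t) - q (Sum.inr t) ≤ d) (x : S) :
    p (Sum.inr x) - q (Sum.inr x) ≤ d := by
  by_contra! hd
  have hx : x ∈ zeroSet p := by
    by_contra hx
    exact hd.not_ge (hout x hx)
  obtain ⟨-, hsub, htight⟩ := zeroSet_of_inr_exceeds hμ hp hq.1 hout hx hd
  have hcol : ColClosed μ q := fun s hs t ht => htight s (hsub hs) t ht
  have hdeg := mem_Qdeg_of_isFat hμ hq (Or.inl hcol)
  refine hn ?_
  suffices h : zeroSet p ⊆ zeroSet q by rwa [Set.Subset.antisymm h hsub]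
  intro y hy
  by_contra hyq
  -- All tight edges of y end in `zeroSet q` although y is outside it; this contradicts column
  -- covering in one case and row closedness in the other.
  obtain ⟨-, -, ⟨-, h⟩ | ⟨h, -⟩⟩ := (mem_Qdeg_iff hμ).1 hdeg
  · obtain ⟨t, htn, ht⟩ := h y hyq
    exact htn (htight y hy t ht)
  · obtain ⟨t, ht⟩ := (mem_Q_iff.1 hq.1).2.1 y
    exact hyq (h t (htight y hy t ht) y ht)

lemma swapPt_mem_Qdeg [Finite S] [Nonempty S] {μ : S → S → ℝ} (hμ : IsDirectedDistance μ) {p : Pt S}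
    {X : Set S} (hp : p ∈ Qdeg μ X) : swapPt p ∈ Qdeg (Function.swap μ) X := by
  rw [mem_Qdeg_iff hμ] at hp
  rw [mem_Qdeg_iff (isDirectedDistance_swap hμ), colClosed_swapPt, colCovered_swapPt,
    zeroSet_swapPt, ← colClosed_swapPt (μ := Function.swap μ),
    ← colCovered_swapPt (μ := Function.swap μ), swapPt_swapPt]
  exact ⟨swapPt_mem_Q hp.1, hp.2.1, hp.2.2.symm⟩

lemma mem_Qdeg_of_swapPt [Finite S] [Nonempty S] {μ : S → S → ℝ} (hμ : IsDirectedDistance μ)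
    {p : Pt S} {X : Set S} (hp : swapPt p ∈ Qdeg (Function.swap μ) X) : p ∈ Qdeg μ X := by
  simpa [Function.swap] using swapPt_mem_Qdeg (isDirectedDistance_swap hμ) hp

lemma swapPt_mem_Qslim [Finite S] [Nonempty S] {μ : S → S → ℝ} (hμ : IsDirectedDistance μ)
    {p : Pt S} (hp : p ∈ Qslim μ) : swapPt p ∈ Qslim (Function.swap μ) := by
  refine ⟨swapPt_mem_Q hp.1, fun h => ?_⟩
  have hfat := ((isFat_iff (isDirectedDistance_swap hμ)).1 h.1).2
  rw [colClosed_swapPt, ← colClosed_swapPt (μ := Function.swap μ), swapPt_swapPt] at hfat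
  exact h.2 _ (zeroSet_mem_zeroSets (isDirectedDistance_swap hμ) (swapPt_mem_P hp.1.1))
    (swapPt_mem_Qdeg hμ (by simpa using mem_Qdeg_of_isFat hμ hp hfat.symm))

lemma sub_inl_le_of_notMem_Qdeg [Finite S] [Nonempty S] {μ : S → S → ℝ} (hμ : IsDirectedDistance μ)
    {p q : Pt S} (hp : p ∈ P μ) (hq : q ∈ Qslim μ) (hn : q ∉ Qdeg μ (zeroSet p)) {d : ℝ}
    (hout : ∀ t ∉ zeroSet p, p (Sum.inl t) - q (Sum.inl t) ≤ d) (x : S) :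
    p (Sum.inl x) - q (Sum.inl x) ≤ d :=
  sub_inr_le_of_notMem_Qdeg (isDirectedDistance_swap hμ) (swapPt_mem_P hp) (swapPt_mem_Qslim hμ hq)
    (fun h => hn (mem_Qdeg_of_swapPt hμ (by simpa using h))) (by simpa using hout) x

/-! ### Moving fats -/

/-- Raise the row coordinates in the zero set by `ε` and take the smallest column part. -/
noncomputable def moveFat (μ : S → S → ℝ) (ε : ℝ) (p : Pt S) : Pt S :=
  Sum.elim (colStar μ fun t => p (Sum.inr t) + (zeroSet p).indicator (fun _ => ε) t)
    (fun t => p (Sum.inr t) + (zeroSet p).indicator (fun _ => ε) t)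

/-- The slack that makes a move by `ε` harmless. -/
def Slack (μ : S → S → ℝ) (ε : ℝ) (p : Pt S) : Prop :=
  (∀ s ∈ zeroSet p, ∀ t ∉ zeroSet p, μ s t + ε < p (Sum.inl s) + p (Sum.inr t)) ∧
    ∀ s ∉ zeroSet p, ε < p (Sum.inl s) + p (Sum.inr s)

/-- Column closedness makes the inequalities leading out of the zero set strict, and there are
finitely many of them. -/
lemma eventually_slack [Finite S] {μ : S → S → ℝ} (hμ : IsDirectedDistance μ) {p : Pt S}
    (hp : p ∈ P μ) (hcol : ColClosed μ p) : ∀ᶠ ε in nhdsWithin (0 : ℝ) (Set.Ioi 0), Slack μ ε p := by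
  have key : ∀ a : ℝ, 0 < a → ∀ᶠ ε in nhdsWithin (0 : ℝ) (Set.Ioi 0), ε < a := fun a ha =>
    nhdsWithin_le_nhds (gt_mem_nhds ha)
  refine Filter.Eventually.and ?_ ?_
  · refine Filter.eventually_all.2 fun s => ?_
    by_cases hs : s ∈ zeroSet p
    · refine Filter.Eventually.mono (p := fun ε => ∀ t, t ∉ zeroSet p →
        μ s t + ε < p (Sum.inl s) + p (Sum.inr t)) (Filter.eventually_all.2 fun t => ?_)
        fun ε h _ t ht => h t ht
      by_cases ht : t ∈ zeroSet p
      · exact Filter.Eventually.of_forall fun _ h => absurd ht h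
      · have h1 : μ s t < p (Sum.inl s) + p (Sum.inr t) :=
          lt_of_le_of_ne (hp s t) fun h => ht (hcol s hs t h.symm)
        exact (key _ (sub_pos.2 h1)).mono fun ε h _ => by linarith
    · exact Filter.Eventually.of_forall fun _ h => absurd h hs
  · refine Filter.eventually_all.2 fun s => ?_
    by_cases hs : s ∈ zeroSet p
    · exact Filter.Eventually.of_forall fun _ h => absurd hs h
    · have h1 : 0 < p (Sum.inl s) + p (Sum.inr s) :=
        lt_of_le_of_ne (by simpa [hμ.2] using hp s s) fun h => hs h.symm
      exact (key _ h1).mono fun ε h _ => h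

variable {μ : S → S → ℝ} {ε : ℝ} {p : Pt S}

lemma moveFat_inr_of_mem {t : S} (ht : t ∈ zeroSet p) :
    moveFat μ ε p (Sum.inr t) = p (Sum.inr t) + ε := by
  simp [moveFat, ht]

lemma moveFat_inr_of_notMem {t : S} (ht : t ∉ zeroSet p) :
    moveFat μ ε p (Sum.inr t) = p (Sum.inr t) := by
  simp [moveFat, ht]

lemma le_moveFat_inr (hε : 0 ≤ ε) (t : S) : p (Sum.inr t) ≤ moveFat μ ε p (Sum.inr t) := by
  by_cases ht : t ∈ zeroSet p
  · rw [moveFat_inr_of_mem ht]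
    linarith
  · rw [moveFat_inr_of_notMem ht]

lemma moveFat_inr_le (hε : 0 ≤ ε) (t : S) : moveFat μ ε p (Sum.inr t) ≤ p (Sum.inr t) + ε := by
  by_cases ht : t ∈ zeroSet p
  · rw [moveFat_inr_of_mem ht]
  · rw [moveFat_inr_of_notMem ht]
    linarith

variable [Finite S] [Nonempty S]

omit [Nonempty S] in
lemma moveFat_mem_P : moveFat μ ε p ∈ P μ := fun s t => by
  have := sub_le_colStar μ (fun t => p (Sum.inr t) + (zeroSet p).indicator (fun _ => ε) t) s t
  simp only [moveFat, Sum.elim_inl, Sum.elim_inr]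
  linarith

lemma exists_tight_moveFat (s : S) : ∃ t, Tight μ (moveFat μ ε p) s t := by
  obtain ⟨t, ht⟩ :=
    exists_colStar_eq μ (fun t => p (Sum.inr t) + (zeroSet p).indicator (fun _ => ε) t) s
  refine ⟨t, ?_⟩
  simp only [Tight, moveFat, Sum.elim_inl, Sum.elim_inr]
  linarith

lemma moveFat_inl_le (hp : p ∈ P μ) (hε : 0 ≤ ε) (s : S) :
    moveFat μ ε p (Sum.inl s) ≤ p (Sum.inl s) := by
  obtain ⟨t, ht⟩ := exists_tight_moveFat (μ := μ) (ε := ε) (p := p) s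
  have := hp s t
  have := le_moveFat_inr (μ := μ) (p := p) hε t
  unfold Tight at ht
  linarith

lemma moveFat_inl_of_mem (hμ : IsDirectedDistance μ) (hp : p ∈ P μ) (hs : Slack μ ε p)
    {s : S} (h : s ∈ zeroSet p) : moveFat μ ε p (Sum.inl s) = p (Sum.inl s) - ε := by
  have hsp : p (Sum.inl s) + p (Sum.inr s) = 0 := h
  apply le_antisymm
  · obtain ⟨t, ht⟩ := exists_tight_moveFat (μ := μ) (ε := ε) (p := p) s
    unfold Tight at ht
    by_cases htp : t ∈ zeroSet p
    · rw [moveFat_inr_of_mem htp, zeroSet_mem_zeroSets hμ hp s h t htp] at ht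
      have := inl_add_inr_of_mem_zeroSet hμ hp h htp
      linarith
    · rw [moveFat_inr_of_notMem htp] at ht
      have := hs.1 s h t htp
      linarith
  · have := moveFat_mem_P (μ := μ) (ε := ε) (p := p) s s
    rw [moveFat_inr_of_mem h, hμ.2] at this
    linarith

lemma le_moveFat_inl (hp : p ∈ Q μ) (hε : 0 ≤ ε) (s : S) :
    p (Sum.inl s) - ε ≤ moveFat μ ε p (Sum.inl s) := by
  obtain ⟨t, ht⟩ := (mem_Q_iff.1 hp).2.1 s
  have := moveFat_mem_P (μ := μ) (ε := ε) (p := p) s t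
  have := moveFat_inr_le (μ := μ) (p := p) hε t
  unfold Tight at ht
  linarith

/-- Outside the zero set the rows are fixed and columns only fall, so an old tight pair stays tight
by feasibility. -/
lemma moveFat_mem_Q (hμ : IsDirectedDistance μ) (hp : p ∈ Q μ) (hε : 0 ≤ ε) (hs : Slack μ ε p) : moveFat μ ε p ∈ Q μ := by
  refine mem_Q_iff.2 ⟨moveFat_mem_P, exists_tight_moveFat, fun t => ?_⟩
  by_cases ht : t ∈ zeroSet p
  · refine ⟨t, ?_⟩
    have : p (Sum.inl t) + p (Sum.inr t) = 0 := ht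
    rw [Tight, moveFat_inl_of_mem hμ hp.1 hs ht, moveFat_inr_of_mem ht, hμ.2]
    linarith
  · obtain ⟨s, hst⟩ := (mem_Q_iff.1 hp).2.2 t
    refine ⟨s, le_antisymm ?_ (moveFat_mem_P s t)⟩
    rw [moveFat_inr_of_notMem ht, ← hst]
    linarith [moveFat_inl_le hp.1 hε s]

lemma zeroSet_moveFat (hμ : IsDirectedDistance μ) (hp : p ∈ Q μ) (hε : 0 ≤ ε)
    (hs : Slack μ ε p) : zeroSet (moveFat μ ε p) = zeroSet p := by
  ext s
  by_cases h : s ∈ zeroSet p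
  · refine iff_of_true ?_ h
    have : p (Sum.inl s) + p (Sum.inr s) = 0 := h
    rw [zeroSet, Set.mem_ofPred_eq, moveFat_inl_of_mem hμ hp.1 hs h, moveFat_inr_of_mem h]
    linarith
  · refine iff_of_false (fun h' => ?_) h
    rw [zeroSet, Set.mem_ofPred_eq, moveFat_inr_of_notMem h] at h'
    linarith [hs.2 s h, le_moveFat_inl hp hε s]

lemma moveFat_inl_add_inr_le (hμ : IsDirectedDistance μ) (hp : p ∈ P μ)
    (hε : 0 ≤ ε) (hs : Slack μ ε p) (s : S) :
    moveFat μ ε p (Sum.inl s) + moveFat μ ε p (Sum.inr s) ≤ p (Sum.inl s) + p (Sum.inr s) := by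
  by_cases h : s ∈ zeroSet p
  · rw [moveFat_inl_of_mem hμ hp hs h, moveFat_inr_of_mem h]
    linarith
  · rw [moveFat_inr_of_notMem h]
    linarith [moveFat_inl_le hp hε s]

/-- All tight edges at an uncovered column lead to raised rows, so this column strictly falls while
its row stays fixed. -/
lemma exists_moveFat_lt (hp : p ∈ P μ) (hε : 0 < ε) (hc : ¬ ColCovered μ p) :
    ∃ s, moveFat μ ε p (Sum.inl s) + moveFat μ ε p (Sum.inr s) <
      p (Sum.inl s) + p (Sum.inr s) := by
  unfold ColCovered at hc
  push Not at hc
  obtain ⟨s, hs, hst⟩ := hc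
  refine ⟨s, ?_⟩
  rw [moveFat_inr_of_notMem hs, add_lt_add_iff_right]
  obtain ⟨t, ht⟩ := exists_tight_moveFat (μ := μ) (ε := ε) (p := p) s
  unfold Tight at ht
  by_cases htp : t ∈ zeroSet p
  · rw [moveFat_inr_of_mem htp] at ht
    linarith [hp s t]
  · rw [moveFat_inr_of_notMem htp] at ht
    have : μ s t < p (Sum.inl s) + p (Sum.inr t) :=
      lt_of_le_of_ne (hp s t) fun h => hst t htp h.symm
    linarith

end Fats

/-! ### Improving a family of minimal points -/

section Improve

variable {S : Type*} [Fintype S] [Nonempty S] {ι : Type*} [Finite ι]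

/-- All column-closed members move simultaneously and by the same ε. If a distance from i to j grew,
`zeroSet_of_inr_exceeds` would show that j moves as well, and the largest difference would occur at
a common zero y, where the two shifts by ε cancel. -/
lemma exists_improvement_of_colClosed {μ : S → S → ℝ} (hμ : IsDirectedDistance μ) (ρ : ι → Pt S)
    (hρ : ∀ i, ρ i ∈ Q μ) : ∃ ρ' : ι → Pt S, (∀ i, ρ' i ∈ Q μ) ∧
      (∀ i j, D0 (ρ' i) (ρ' j) ≤ D0 (ρ i) (ρ j)) ∧ (∀ i, zeroSet (ρ' i) = zeroSet (ρ i)) ∧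
      (∀ i, ¬ ColClosed μ (ρ i) → ρ' i = ρ i) ∧ (∀ i, ∑ u, ρ' i u ≤ ∑ u, ρ i u) ∧
      ∀ i, ColClosed μ (ρ i) → ¬ ColCovered μ (ρ i) → ∑ u, ρ' i u < ∑ u, ρ i u := by
  classical
  have hev : ∀ᶠ ε in nhdsWithin (0 : ℝ) (Set.Ioi 0), ∀ i, ColClosed μ (ρ i) → Slack μ ε (ρ i) := by
    refine Filter.eventually_all.2 fun i => ?_
    by_cases h : ColClosed μ (ρ i)
    · exact (eventually_slack hμ (hρ i).1 h).mono fun _ h _ => h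
    · exact Filter.Eventually.of_forall fun _ h' => absurd h' h
  obtain ⟨ε, hs, hε⟩ := (hev.and self_mem_nhdsWithin).exists
  have hε : 0 < ε := hε
  set ρ' : ι → Pt S := fun i => if ColClosed μ (ρ i) then moveFat μ ε (ρ i) else ρ i with hρ'
  have hpos : ∀ i, ColClosed μ (ρ i) → ρ' i = moveFat μ ε (ρ i) := fun i h => if_pos h
  have hneg : ∀ i, ¬ ColClosed μ (ρ i) → ρ' i = ρ i := fun i h => if_neg h
  have hQ : ∀ i, ρ' i ∈ Q μ := fun i => by
    by_cases h : ColClosed μ (ρ i)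
    · rw [hpos i h]
      exact moveFat_mem_Q hμ (hρ i) hε.le (hs i h)
    · rw [hneg i h]
      exact hρ i
  have hz : ∀ i, zeroSet (ρ' i) = zeroSet (ρ i) := fun i => by
    by_cases h : ColClosed μ (ρ i)
    · rw [hpos i h]
      exact zeroSet_moveFat hμ (hρ i) hε.le (hs i h)
    · rw [hneg i h]
  have hr : ∀ i t, ρ i (Sum.inr t) ≤ ρ' i (Sum.inr t) := fun i t => by
    by_cases h : ColClosed μ (ρ i)
    · rw [hpos i h]
      exact le_moveFat_inr hε.le t
    · rw [hneg i h]
  have hsum : ∀ p : Pt S, ∑ u, p u = ∑ s, (p (Sum.inl s) + p (Sum.inr s)) := fun p => by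
    rw [Fintype.sum_sum_type, Finset.sum_add_distrib]
  refine ⟨ρ', hQ, fun i j => D0_le_of_inr (hQ i).1 (hQ j) ?_, hz, hneg, fun i => ?_,
    fun i h hc => ?_⟩
  · by_cases h : ColClosed μ (ρ i)
    · have hout : ∀ t ∉ zeroSet (ρ' i), ρ' i (Sum.inr t) - ρ' j (Sum.inr t) ≤ D0 (ρ i) (ρ j) := by
        intro t ht
        rw [hz] at ht
        rw [hpos i h, moveFat_inr_of_notMem ht]
        linarith [hr j t, sub_inr_le_D0 (ρ i) (ρ j) t]
      intro x
      by_contra! hd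
      by_cases hx : x ∈ zeroSet (ρ' i)
      · obtain ⟨⟨y, hyj, hyi, hmin⟩, hsub, htight⟩ :=
          zeroSet_of_inr_exceeds hμ (hQ i).1 (hQ j) hout hx hd
        have hj : ColClosed μ (ρ j) := by
          by_contra hj
          refine hj ?_
          rw [← hneg j hj]
          exact fun s hs t ht => htight s (hsub hs) t ht
        have h1 := hmin x hx
        have h2 : ρ' i (Sum.inr x) = ρ' i (Sum.inr y) := by
          have := inl_eq_of_mem_zeroSet hμ (hQ i).1 hx hyi
          simp only [zeroSet, Set.mem_ofPred_eq] at hx hyi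
          linarith
        rw [hz] at hyj hyi
        rw [hpos i h, moveFat_inr_of_mem hyi] at h2
        rw [hpos j hj, moveFat_inr_of_mem hyj] at h1
        have := sub_inr_le_D0 (ρ i) (ρ j) y
        rw [hpos i h, hpos j hj] at hd
        linarith
      · exact hd.not_ge (hout x hx)
    · intro t
      rw [hneg i h]
      linarith [hr j t, sub_inr_le_D0 (ρ i) (ρ j) t]
  · by_cases h : ColClosed μ (ρ i)
    · rw [hpos i h, hsum, hsum]
      exact Finset.sum_le_sum fun s _ => moveFat_inl_add_inr_le hμ (hρ i).1 hε.le (hs i h) s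
    · rw [hneg i h]
  · rw [hpos i h, hsum, hsum]
    obtain ⟨s, hlt⟩ := exists_moveFat_lt (hρ i).1 hε hc
    exact Finset.sum_lt_sum
      (fun s _ => moveFat_inl_add_inr_le hμ (hρ i).1 hε.le (hs i h) s) ⟨s, Finset.mem_univ s, hlt⟩

/-- If a family in `Q μ` contains a proper fat, then its sum can be decreased without increasing
signed distances and without moving the points that are no fats. -/
lemma exists_improvement_of_isProperFat {μ : S → S → ℝ} (hμ : IsDirectedDistance μ) (ρ : ι → Pt S)
    (hρ : ∀ i, ρ i ∈ Q μ) {i₀ : ι} (h₀ : IsProperFat μ (ρ i₀)) : ∃ ρ' : ι → Pt S,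
      (∀ i, ρ' i ∈ Q μ) ∧ (∀ i j, D0 (ρ' i) (ρ' j) ≤ D0 (ρ i) (ρ j)) ∧
      (∀ i, zeroSet (ρ' i) = zeroSet (ρ i)) ∧ (∀ i, ¬ IsFat μ (ρ i) → ρ' i = ρ i) ∧
      (∀ i, ∑ u, ρ' i u ≤ ∑ u, ρ i u) ∧ ∑ u, ρ' i₀ u < ∑ u, ρ i₀ u := by
  have hdeg := h₀.2 _ (zeroSet_mem_zeroSets hμ (hρ i₀).1)
  rw [mem_Qdeg_iff hμ] at hdeg
  push Not at hdeg
  obtain ⟨hc, hr⟩ := hdeg (hρ i₀) rfl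
  rcases ((isFat_iff hμ).1 h₀.1).2 with h | h
  · obtain ⟨ρ', h1, h2, h3, h4, h5, h6⟩ := exists_improvement_of_colClosed hμ ρ hρ
    exact ⟨ρ', h1, h2, h3, fun i hi => h4 i fun h => hi ((isFat_iff hμ).2 ⟨hρ i, Or.inl h⟩), h5,
      h6 i₀ h (hc h)⟩
  -- Exchanging the copies turns row closedness into column closedness, transposes μ and reverses
  -- the arguments of `D0`.
  · obtain ⟨ρ', h1, h2, h3, h4, h5, h6⟩ := exists_improvement_of_colClosed
      (isDirectedDistance_swap hμ) (fun i => swapPt (ρ i)) (fun i => swapPt_mem_Q (hρ i))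
    simp only [colClosed_swapPt, colCovered_swapPt, sum_swapPt, zeroSet_swapPt, D0_swapPt] at h2 h3 h4 h5 h6
    refine ⟨fun i => swapPt (ρ' i), fun i => ?_, fun i j => ?_, fun i => ?_, fun i hi => ?_,
      fun i => ?_, ?_⟩
    · simpa [Function.swap] using swapPt_mem_Q (h1 i)
    · rw [D0_swapPt]
      exact h2 j i
    · simpa using h3 i
    · have := h4 i fun h => hi ((isFat_iff hμ).2 ⟨hρ i, Or.inr h⟩)
      simp [this]
    · simpa only [sum_swapPt] using h5 i
    · simpa only [sum_swapPt] using h6 i₀ h (hr h)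

end Improve

/-! ### Linear programming duality for packing problems -/

section Duality

open Classical in
/-- Strong duality for fractional packing, with the optimum of the packing attained. -/
lemma exists_packing_dual {ι E : Type*} [Fintype ι] [Fintype E] (A : ι → E → Prop) (c : E → ℝ)
    (hc : ∀ e, 0 ≤ c e) (m : ι → ℝ) (hA : ∀ i, ∃ e, A i e) :
    ∃ f : ι → ℝ, (∀ i, 0 ≤ f i) ∧ (∀ e, ∑ i with A i e, f i ≤ c e) ∧
      ∃ l : E → ℝ, (∀ e, 0 ≤ l e) ∧ (∀ i, m i ≤ ∑ e with A i e, l e) ∧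
        ∑ e, c e * l e ≤ ∑ i, f i * m i := by
  set F : Set (ι → ℝ) := {f | (∀ i, 0 ≤ f i) ∧ ∀ e, ∑ i with A i e, f i ≤ c e} with hF
  have hFc : IsClosed F := by
    have h1 : IsClosed {f : ι → ℝ | ∀ i, 0 ≤ f i} := by
      simp only [Set.ofPred_forall]
      exact isClosed_iInter fun i => isClosed_le continuous_const (continuous_apply i)
    have h2 : IsClosed {f : ι → ℝ | ∀ e, ∑ i with A i e, f i ≤ c e} := by
      simp only [Set.ofPred_forall]
      exact isClosed_iInter fun e => isClosed_le
        (continuous_finsetSum _ fun i _ => continuous_apply i) continuous_const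
    exact h1.inter h2
  have hFb : F ⊆ Set.Icc 0 (fun _ => ∑ e, c e) := by
    rintro f ⟨h0, h1⟩
    refine ⟨h0, fun i => ?_⟩
    obtain ⟨e, he⟩ := hA i
    calc f i ≤ ∑ i with A i e, f i :=
          Finset.single_le_sum (f := f) (fun j _ => h0 j) (by simpa using he)
      _ ≤ c e := h1 e
      _ ≤ ∑ e, c e := Finset.single_le_sum (f := c) (fun e _ => hc e) (Finset.mem_univ e)
  have hcomp : IsCompact F := isCompact_Icc.of_isClosed_subset hFc hFb
  have h0F : (0 : ι → ℝ) ∈ F := ⟨fun _ => le_rfl, fun e => by simpa using hc e⟩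
  obtain ⟨f₀, hf₀, hmax⟩ := hcomp.exists_isMaxOn ⟨0, h0F⟩
    (f := fun f : ι → ℝ => ∑ i, f i * m i) (by fun_prop)
  replace hmax : ∀ f ∈ F, ∑ i, f i * m i ≤ ∑ i, f₀ i * m i := fun f hf => hmax hf
  set v := ∑ i, f₀ i * m i with hv
  have hv0 : 0 ≤ v := by simpa using hmax 0 h0F
  refine ⟨f₀, hf₀.1, hf₀.2, ?_⟩
  -- Perturbations (u, w) for which some packing has loads strictly below c + u and value strictly
  -- above w. B is open and convex and misses (0, v), so a separating functional yields the dual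
  -- solution. Forbidding members through zero capacities keeps the zero packing strictly feasible.
  set B : Set ((E → ℝ) × ℝ) := {a | ∃ f : ι → ℝ, (∀ i, 0 ≤ f i) ∧
    (∀ i, (∃ e, A i e ∧ c e = 0) → f i = 0) ∧
    (∀ e, 0 < c e → ∑ i with A i e, f i < c e + a.1 e) ∧ a.2 < ∑ i, f i * m i} with hB
  have hBo : IsOpen B := by
    have : B = ⋃ f ∈ {f : ι → ℝ | (∀ i, 0 ≤ f i) ∧ ∀ i, (∃ e, A i e ∧ c e = 0) → f i = 0},
        ((⋂ e, {a : (E → ℝ) × ℝ | 0 < c e → ∑ i with A i e, f i < c e + a.1 e}) ∩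
          {a | a.2 < ∑ i, f i * m i}) := by
      ext a
      simp only [hB, Set.mem_ofPred_eq, Set.mem_iUnion, Set.mem_inter_iff, Set.mem_iInter,
        exists_prop, and_assoc]
    rw [this]
    refine isOpen_biUnion fun f _ => IsOpen.inter (isOpen_iInter_of_finite fun e => ?_) ?_
    · by_cases he : 0 < c e
      · simp only [he, forall_const]
        exact isOpen_lt continuous_const (by fun_prop)
      · simp [he]
    · exact isOpen_lt (by fun_prop) continuous_const
  have hBc : Convex ℝ B := by
    rintro ⟨u, w⟩ ⟨f, f1, f2, f3, f4⟩ ⟨u', w'⟩ ⟨g, g1, g2, g3, g4⟩ a b ha hb hab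
    refine ⟨fun i => a * f i + b * g i, fun i => ?_, fun i hi => ?_, fun e he => ?_, ?_⟩
    · have := f1 i
      have := g1 i
      positivity
    · simp [f2 i hi, g2 i hi]
    · have h1 := f3 e he
      have h2 := g3 e he
      simp only [Finset.sum_add_distrib, ← Finset.mul_sum, Prod.fst_add, Prod.smul_fst,
        Pi.add_apply, Pi.smul_apply, smul_eq_mul] at h1 h2 ⊢
      have h3 : c e = a * c e + b * c e := by rw [← add_mul, hab, one_mul]
      rcases ha.eq_or_lt with rfl | ha
      · simp only [zero_add] at hab
        subst hab
        linarith
      · nlinarith [mul_lt_mul_of_pos_left h1 ha, mul_le_mul_of_nonneg_left h2.le hb]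
    · simp only [add_mul, mul_assoc, Finset.sum_add_distrib, ← Finset.mul_sum, Prod.snd_add,
        Prod.smul_snd, smul_eq_mul] at f4 g4 ⊢
      rcases ha.eq_or_lt with rfl | ha
      · simp only [zero_add] at hab
        subst hab
        linarith
      · nlinarith [mul_lt_mul_of_pos_left f4 ha, mul_le_mul_of_nonneg_left g4.le hb]
  have hvB : ((0 : E → ℝ), v) ∉ B := by
    rintro ⟨f, f1, f2, f3, f4⟩
    refine absurd (hmax f ⟨f1, fun e => ?_⟩) (not_le.2 f4)
    rcases (hc e).eq_or_lt with he | he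
    · rw [← he]
      refine (Finset.sum_eq_zero fun i hi => f2 i ⟨e, ?_, he.symm⟩).le
      simpa using hi
    · simpa using (f3 e he).le
  obtain ⟨φ, hφ⟩ := geometric_hahn_banach_open_point hBc hBo hvB
  set L : E → ℝ := fun e => φ (Pi.single e 1, 0) with hL
  set τ : ℝ := φ (0, 1) with hτ
  have hexp : ∀ u w, φ (u, w) = ∑ e, L e * u e + τ * w := by
    intro u w
    have h1 : ((u, w) : (E → ℝ) × ℝ) =
        ∑ e, u e • ((Pi.single e 1, 0) : (E → ℝ) × ℝ) + w • ((0, 1) : (E → ℝ) × ℝ) := by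
      refine Prod.ext ?_ ?_
      · funext e
        simp [Prod.fst_sum, Finset.sum_apply, Pi.single_apply]
      · simp [Prod.snd_sum]
    rw [h1, map_add, map_sum, map_smul]
    simp only [map_smul, smul_eq_mul, hL, hτ, mul_comm]
  have hφ' : ∀ u w, (u, w) ∈ B → ∑ e, L e * u e + τ * w < τ * v := by
    intro u w h
    have := hφ _ h
    rw [hexp, hexp] at this
    simpa using this
  have hτ0 : 0 < τ := by
    have := hφ' 0 (-1) ⟨0, by simp, by simp, fun e he => by simpa using he, by simp⟩
    simp only [Pi.zero_apply, mul_zero, Finset.sum_const_zero] at this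
    nlinarith
  -- B is closed under raising u, so a positive coefficient would make the functional unbounded on
  -- B.
  have hL0 : ∀ e, L e ≤ 0 := by
    intro e
    by_contra! he
    have hK : 0 ≤ (τ * v + τ) / L e := by positivity
    have := hφ' (Pi.single e ((τ * v + τ) / L e)) (-1)
      ⟨0, by simp, by simp, fun e' he' => ?_, by simp⟩
    · simp only [Pi.single_apply, mul_ite, mul_zero, Finset.sum_ite_eq', Finset.mem_univ,
        if_true, mul_div_cancel₀ _ he.ne'] at this
      linarith
    · have : 0 ≤ (Pi.single e ((τ * v + τ) / L e) : E → ℝ) e' := by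
        rw [Pi.single_apply]
        split_ifs <;> simp [hK]
      simp only [Pi.zero_apply, Finset.sum_const_zero]
      linarith
  have hflow : ∀ f : ι → ℝ, (∀ i, 0 ≤ f i) → (∀ i, (∃ e, A i e ∧ c e = 0) → f i = 0) →
      ∀ δ, 0 < δ → ∑ e, L e * (∑ i with A i e, f i) - ∑ e, L e * c e + δ * (∑ e, L e) +
        τ * (∑ i, f i * m i) - τ * δ < τ * v := by
    intro f f1 f2 δ hδ
    have := hφ' (fun e => (∑ i with A i e, f i) - c e + δ) ((∑ i, f i * m i) - δ)
      ⟨f, f1, f2, fun e _ => by linarith, by linarith⟩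
    simp only [mul_add, mul_sub, Finset.sum_add_distrib, Finset.sum_sub_distrib,
      ← Finset.sum_mul] at this
    linarith
  have hval : - ∑ e, L e * c e ≤ τ * v := by
    refine le_of_forall_pos_le_add fun η hη => ?_
    have hs : ∑ e, L e ≤ 0 := Finset.sum_nonpos fun e _ => hL0 e
    have hD : 0 < τ - ∑ e, L e := by linarith
    have := hflow 0 (by simp) (by simp) (η / (τ - ∑ e, L e)) (by positivity)
    simp only [Pi.zero_apply, Finset.sum_const_zero, mul_zero, zero_mul] at this
    have h2 : η / (τ - ∑ e, L e) * (τ - ∑ e, L e) = η := div_mul_cancel₀ _ hD.ne'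
    nlinarith
  -- Otherwise a large multiple of the single member i would violate the separation.
  have hpath : ∀ i, (¬ ∃ e, A i e ∧ c e = 0) → τ * m i ≤ - ∑ e with A i e, L e := by
    intro i hi
    by_contra! h
    set b := τ * v + τ + ∑ e, L e * c e - ∑ e, L e with hb
    set a := τ * m i + ∑ e with A i e, L e with ha
    have ha0 : 0 < a := by linarith
    have hb0 : 0 ≤ max b 0 / a := by positivity
    have := hflow (Pi.single i (max b 0 / a)) (fun j => ?_) (fun j hj => ?_) 1 one_pos
    · simp only [Pi.single_apply, Finset.sum_ite_eq', Finset.mem_filter, Finset.mem_univ, true_and,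
        ite_mul, zero_mul, if_true, mul_ite, mul_zero, one_mul, mul_one] at this
      rw [← Finset.sum_filter, ← Finset.sum_mul] at this
      have h3 : max b 0 / a * a = max b 0 := div_mul_cancel₀ _ ha0.ne'
      have h4 := le_max_left b 0
      nlinarith
    · rw [Pi.single_apply]
      split_ifs <;> simp [hb0]
    · rw [Pi.single_apply, if_neg]
      rintro rfl
      exact hi hj
  have hM : 0 ≤ ∑ i, |m i| := Finset.sum_nonneg fun i _ => abs_nonneg _
  have hl : ∀ e, 0 ≤ -L e / τ := fun e => div_nonneg (neg_nonneg.2 (hL0 e)) hτ0.le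
  -- Elements of capacity zero cost nothing, so they may carry a weight covering the members on
  -- which separation gives no information.
  refine ⟨fun e => -L e / τ + if c e = 0 then ∑ i, |m i| else 0, fun e => ?_, fun i => ?_, ?_⟩
  · have := hl e
    dsimp only
    split_ifs <;> linarith
  · by_cases hi : ∃ e, A i e ∧ c e = 0
    · obtain ⟨e, he, hce⟩ := hi
      calc m i ≤ |m i| := le_abs_self _
        _ ≤ ∑ i, |m i| :=
          Finset.single_le_sum (f := fun i => |m i|) (fun i _ => abs_nonneg _) (Finset.mem_univ i)
        _ ≤ -L e / τ + if c e = 0 then ∑ i, |m i| else 0 := by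
          rw [if_pos hce]
          linarith [hl e]
        _ ≤ _ := Finset.single_le_sum
          (f := fun e => -L e / τ + if c e = 0 then ∑ i, |m i| else 0) (fun e _ => by
            have := hl e
            split_ifs <;> linarith) (by simpa using he)
    · have h1 := hpath i hi
      have h2 : m i ≤ ∑ e with A i e, -L e / τ := by
        rw [← Finset.sum_div, Finset.sum_neg_distrib, le_div_iff₀ hτ0]
        linarith
      refine h2.trans (Finset.sum_le_sum fun e _ => ?_)
      split_ifs <;> linarith
  · have h1 : ∀ e, c e * (-L e / τ + if c e = 0 then ∑ i, |m i| else 0) = -(L e * c e) / τ := by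
      intro e
      split_ifs with h
      · simp [h]
      · ring
    rw [Finset.sum_congr rfl fun e _ => h1 e, ← Finset.sum_div, Finset.sum_neg_distrib,
      div_le_iff₀ hτ0]
    linarith

end Duality

/-! ### Paths and walks -/

section Paths

variable {S V : Type*}

instance (N : Network S V) [Finite S] [Finite V] : Finite (SPath N) := by
  have := Fintype.ofFinite V
  refine Finite.of_injective (β := {l : List V // l.Nodup} × S × S)
    (fun P => (⟨P.nodes, P.nodup⟩, P.source, P.target)) ?_
  rintro ⟨⟩ ⟨⟩ h
  simp only [Prod.mk.injEq, Subtype.mk.injEq] at h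
  obtain ⟨rfl, rfl, rfl⟩ := h
  rfl

lemma pair_infix_cons_cons {x y a b : V} {l : List V} :
    [x, y] <:+: a :: b :: l ↔ (x = a ∧ y = b) ∨ [x, y] <:+: b :: l := by
  rw [List.infix_cons_iff]
  simp [List.cons_prefix_cons]

open Classical in
/-- Potential differences are bounded by the length of a path. -/
lemma sub_le_sum_of_isChain (N : Network S V) (w : N.edges → ℝ) (hw : ∀ e, 0 ≤ w e) (g : V → ℝ)
    (hg : ∀ e : N.edges, g e.1.2 - g e.1.1 ≤ w e) (l : List V) (a b : V) (hl : l.Nodup)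
    (hc : l.IsChain (fun x y => (x, y) ∈ N.edges)) (ha : l.head? = some a)
    (hb : l.getLast? = some b) :
    g b - g a ≤ ∑ e : N.edges with [e.1.1, e.1.2] <:+: l, w e := by
  induction l generalizing a with
  | nil => simp at ha
  | cons x l ih =>
    simp only [List.head?_cons, Option.some.injEq] at ha
    subst ha
    cases l with
    | nil =>
      simp only [List.getLast?_singleton, Option.some.injEq] at hb
      subst hb
      simpa using Finset.sum_nonneg fun e _ => hw e
    | cons y l =>
      rw [List.isChain_cons_cons] at hc
      have h1 := ih y (List.nodup_cons.1 hl).2 hc.2 rfl (by simpa using hb)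
      -- The sum runs over a set of edges; as x does not recur, the first edge is counted anew.
      have hx : (⟨(x, y), hc.1⟩ : N.edges) ∉
          ({e : N.edges | [e.1.1, e.1.2] <:+: y :: l} : Finset N.edges) := by
        intro h
        simp only [Finset.mem_filter, Finset.mem_univ, true_and] at h
        exact (List.nodup_cons.1 hl).1 (h.subset (by simp))
      have h2 : ({e : N.edges | [e.1.1, e.1.2] <:+: x :: y :: l} : Finset N.edges) =
          insert ⟨(x, y), hc.1⟩ ({e : N.edges | [e.1.1, e.1.2] <:+: y :: l} : Finset N.edges) := by
        ext e
        simp [pair_infix_cons_cons, Subtype.ext_iff, Prod.ext_iff]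
      rw [h2, Finset.sum_insert hx]
      have := hg ⟨(x, y), hc.1⟩
      simp only at this
      linarith

/-- Distinct terminals are distinct nodes, so a path has an edge; this bounds the flow values in
`exists_packing_dual`. -/
lemma exists_uses (N : Network S V) (P : SPath N) : ∃ e : N.edges, P.Uses e.1 := by
  obtain ⟨l, s, t, hst, hs, ht, hn, hc⟩ := P
  rcases l with _ | ⟨x, _ | ⟨y, l⟩⟩
  · simp at hs
  · simp only [List.head?_cons, Option.some.injEq, List.getLast?_singleton] at hs ht
    exact absurd (N.terminal.injective (hs.symm.trans ht)) hst
  · exact ⟨⟨(x, y), (List.isChain_cons_cons.1 hc).1⟩, [], l, rfl⟩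

/-- There is a walk from `x` to `y` of length `r`. -/
inductive WalkLength (N : Network S V) (w : N.edges → ℝ) : V → V → ℝ → Prop
  | refl (x : V) : WalkLength N w x x 0
  | step {x y z : V} {r : ℝ} (h : WalkLength N w x y r) (he : (y, z) ∈ N.edges) :
      WalkLength N w x z (r + w ⟨(y, z), he⟩)

lemma WalkLength.trans {N : Network S V} {w : N.edges → ℝ} {x y z : V} {r r' : ℝ}
    (h : WalkLength N w x y r) (h' : WalkLength N w y z r') : WalkLength N w x z (r + r') := by
  induction h' with
  | refl => simpa using h
  | step _ he ih =>
    rw [← add_assoc]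
    exact ih.step he

lemma WalkLength.edge {N : Network S V} {w : N.edges → ℝ} {x y : V} (he : (x, y) ∈ N.edges) :
    WalkLength N w x y (w ⟨(x, y), he⟩) := by
  simpa using (WalkLength.refl (w := w) x).step he

lemma WalkLength.nonneg {N : Network S V} {w : N.edges → ℝ} (hw : ∀ e, 0 ≤ w e) {x y : V} {r : ℝ}
    (h : WalkLength N w x y r) : 0 ≤ r := by
  induction h with
  | refl => exact le_rfl
  | step _ he ih => exact add_nonneg ih (hw _)

open Classical in
/-- A walk contains a path that is not longer. -/
lemma WalkLength.exists_path {N : Network S V} {w : N.edges → ℝ} (hw : ∀ e, 0 ≤ w e) {x y : V}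
    {r : ℝ} (h : WalkLength N w x y r) : ∃ l : List V, l.head? = some x ∧ l.getLast? = some y ∧
      l.Nodup ∧ l.IsChain (fun x y => (x, y) ∈ N.edges) ∧
      ∑ e : N.edges with [e.1.1, e.1.2] <:+: l, w e ≤ r := by
  induction h with
  | refl =>
    refine ⟨[x], rfl, rfl, by simp, by simp, (Finset.sum_eq_zero fun e he => ?_).le⟩
    have := (Finset.mem_filter.1 he).2.length_le
    simp at this
  | @step y z r _ he ih =>
    obtain ⟨l, h1, h2, h3, h4, h5⟩ := ih
    -- If z is already on the path, cut the path off there; otherwise append z.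
    by_cases hz : z ∈ l
    · obtain ⟨a, b, rfl⟩ := List.append_of_mem hz
      have hpre : a ++ [z] <+: a ++ z :: b := ⟨b, by simp⟩
      refine ⟨a ++ [z], ?_, by simp, h3.sublist hpre.sublist, h4.prefix hpre, ?_⟩
      · cases a <;> simpa using h1
      · refine (Finset.sum_le_sum_of_subset_of_nonneg (fun e h => ?_) fun e _ _ => hw e).trans
          (h5.trans (le_add_of_nonneg_right (hw _)))
        simp only [Finset.mem_filter, Finset.mem_univ, true_and] at h ⊢
        exact h.trans hpre.isInfix
    · refine ⟨l ++ [z], ?_, by simp, ?_, ?_, ?_⟩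
      · cases l <;> simp_all
      · rw [List.nodup_append]
        refine ⟨h3, by simp, fun a ha b hb => ?_⟩
        simp only [List.mem_singleton] at hb
        subst hb
        rintro rfl
        exact hz ha
      · rw [List.isChain_append]
        refine ⟨h4, by simp, fun a ha b hb => ?_⟩
        rw [h2] at ha
        simp at ha hb
        subst ha hb
        exact he
      · have hsub : ({e : N.edges | [e.1.1, e.1.2] <:+: l ++ [z]} : Finset N.edges) ⊆
            insert ⟨(y, z), he⟩ ({e : N.edges | [e.1.1, e.1.2] <:+: l} : Finset N.edges) := by
          intro e h
          simp only [Finset.mem_filter, Finset.mem_univ, true_and, Finset.mem_insert] at h ⊢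
          rcases List.infix_concat_iff.1 h with ⟨t, ht⟩ | h
          · left
            have h6 : (t ++ [e.1.1]) ++ [e.1.2] = l ++ [z] := by simpa using ht
            obtain ⟨h7, h8⟩ := List.append_inj' h6 rfl
            rw [← h7] at h2
            simp at h2 h8
            exact Subtype.ext (Prod.ext h2 h8)
          · exact Or.inr h
        have h6 := Finset.sum_le_sum_of_subset_of_nonneg hsub fun e _ _ => hw e
        by_cases hy : (⟨(y, z), he⟩ : N.edges) ∈
            ({e : N.edges | [e.1.1, e.1.2] <:+: l} : Finset N.edges)
        · rw [Finset.insert_eq_of_mem hy] at h6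
          linarith [hw ⟨(y, z), he⟩]
        · rw [Finset.sum_insert hy] at h6
          linarith

/-- The walk distance, truncated at `M`. -/
noncomputable def truncDist (N : Network S V) (w : N.edges → ℝ) (M : ℝ) (x y : V) : ℝ :=
  sInf (insert M {r | WalkLength N w x y r})

section truncDist

variable {N : Network S V} {w : N.edges → ℝ} {M : ℝ}

lemma truncDist_nonneg (hw : ∀ e, 0 ≤ w e) (hM : 0 ≤ M) (x y : V) : 0 ≤ truncDist N w M x y := by
  refine Real.sInf_nonneg ?_
  rintro r (rfl | h)
  exacts [hM, h.nonneg hw]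

lemma truncDist_le (hw : ∀ e, 0 ≤ w e) (hM : 0 ≤ M) {x y : V} {r : ℝ}
    (hr : r = M ∨ WalkLength N w x y r) : truncDist N w M x y ≤ r := by
  refine csInf_le ⟨0, ?_⟩ hr
  rintro r (rfl | h)
  exacts [hM, h.nonneg hw]

lemma le_truncDist {x y : V} {b : ℝ} (hb : b ≤ M) (h : ∀ r, WalkLength N w x y r → b ≤ r) :
    b ≤ truncDist N w M x y := by
  refine le_csInf ⟨M, by simp⟩ ?_
  rintro r (rfl | hr)
  exacts [hb, h r hr]

lemma truncDist_self (hw : ∀ e, 0 ≤ w e) (hM : 0 ≤ M) (x : V) : truncDist N w M x x = 0 :=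
  le_antisymm (truncDist_le hw hM (Or.inr (.refl x))) (truncDist_nonneg hw hM x x)

lemma truncDist_le_add_edge (hw : ∀ e, 0 ≤ w e) (hM : 0 ≤ M) (x : V) (e : N.edges) :
    truncDist N w M x e.1.2 - truncDist N w M x e.1.1 ≤ w e := by
  rw [sub_le_iff_le_add', ← sub_le_iff_le_add]
  refine le_truncDist ?_ fun r hr => ?_
  · linarith [hw e, truncDist_le hw hM (x := x) (y := e.1.2) (Or.inl rfl)]
  · linarith [truncDist_le hw hM (Or.inr (hr.step e.2))]

lemma truncDist_le_edge_add (hw : ∀ e, 0 ≤ w e) (hM : 0 ≤ M) (x : V) (e : N.edges) :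
    truncDist N w M e.1.1 x - truncDist N w M e.1.2 x ≤ w e := by
  rw [sub_le_iff_le_add', ← sub_le_iff_le_add]
  refine le_truncDist ?_ fun r hr => ?_
  · linarith [hw e, truncDist_le hw hM (x := e.1.1) (y := x) (Or.inl rfl)]
  · linarith [truncDist_le hw hM (Or.inr ((WalkLength.edge e.2).trans hr))]

end truncDist

/-! ### Optimal multiflows -/

open Classical in
lemma Multiflow.val_le {N : Network S V} {μ : S → S → ℝ} (f : Multiflow N) (w : N.edges → ℝ)
    (hw : ∀ e, 0 ≤ w e) (h : ∀ P : SPath N, μ P.source P.target ≤ ∑ e : N.edges with P.Uses e.1, w e) :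
    f.val μ ≤ ∑ e, (N.cap e : ℝ) * w e := by
  calc f.val μ ≤ ∑ P ∈ f.paths, (f.flow P : ℝ) * ∑ e : N.edges with P.Uses e.1, w e :=
        Finset.sum_le_sum fun P _ => mul_le_mul_of_nonneg_left (h P) (f.flow P).2
    _ = ∑ e : N.edges, (∑ P ∈ f.paths with P.Uses e.1, (f.flow P : ℝ)) * w e := by
        simp only [Finset.mul_sum, Finset.sum_mul, Finset.sum_filter]
        rw [Finset.sum_comm]
        simp only [ite_mul, zero_mul, mul_ite, mul_zero]
    _ ≤ _ := Finset.sum_le_sum fun e _ => mul_le_mul_of_nonneg_right (f.capacity e) (hw e)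

open Classical in
/-- The maximum of the multiflow problem is attained, and so is its linear programming dual. -/
lemma exists_isMFPOpt [Finite S] [Finite V] (μ : S → S → ℝ) (N : Network S V) :
    ∃ v, IsMFPOpt μ N v ∧ ∃ w : N.edges → ℝ, (∀ e, 0 ≤ w e) ∧
      (∀ P : SPath N, μ P.source P.target ≤ ∑ e : N.edges with P.Uses e.1, w e) ∧
      ∑ e, (N.cap e : ℝ) * w e ≤ v := by
  have := Fintype.ofFinite (SPath N)
  obtain ⟨f, f0, f1, w, w0, w1, w2⟩ := exists_packing_dual
    (fun (P : SPath N) (e : N.edges) => P.Uses e.1) (fun e => (N.cap e : ℝ))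
    (fun e => Nat.cast_nonneg _) (fun P => μ P.source P.target) (exists_uses N)
  let F : Multiflow N := ⟨Finset.univ, fun P => ⟨f P, f0 P⟩, f1⟩
  refine ⟨F.val μ, ⟨⟨F, rfl⟩, ?_⟩, w, w0, w1, w2⟩
  rintro _ ⟨g, rfl⟩
  exact (g.val_le w w0 w1).trans w2

end Paths

/-! ### Signed facility location -/

section Location

variable {S V : Type*}

/-- The objective value of the facility location problem for signed distances. -/
noncomputable def cost0 (N : Network S V) (ρ : V → Pt S) : ℝ :=
  ∑ e : N.edges, (N.cap e : ℝ) * D0 (ρ e.1.1) (ρ e.1.2)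

open Classical in
-- Grouped by nodes, the coefficient of h(x) is the entering minus the leaving capacity.
lemma sum_cap_mul_sub [Finite V] (N : Network S V) (h : V → ℝ)
    (hh : ∀ x, h x = 0 ∨ N.EulerianAt x) :
    ∑ e : N.edges, (N.cap e : ℝ) * (h e.1.2 - h e.1.1) = 0 := by
  have := Fintype.ofFinite V
  have key : ∀ g : N.edges → V, ∑ e : N.edges, (N.cap e : ℝ) * h (g e) =
      ∑ x, ((∑ e : N.edges with g e = x, N.cap e : ℕ) : ℝ) * h x := by
    intro g
    rw [← Finset.sum_fiberwise (s := Finset.univ) (g := g)]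
    refine Finset.sum_congr rfl fun x _ => ?_
    rw [Nat.cast_sum, Finset.sum_mul]
    refine Finset.sum_congr rfl fun e he => ?_
    rw [(Finset.mem_filter.1 he).2]
  simp only [mul_sub, Finset.sum_sub_distrib]
  rw [key (fun e => e.1.2), key (fun e => e.1.1), ← Finset.sum_sub_distrib]
  refine Finset.sum_eq_zero fun x _ => ?_
  rcases hh x with hx | hx
  · simp [hx]
  · rw [Network.EulerianAt] at hx
    rw [hx, sub_self]

lemma cost0_translate [Finite S] [Nonempty S] [Finite V] (N : Network S V) (ρ : V → Pt S)
    (h : V → ℝ) (hh : ∀ x, h x = 0 ∨ N.EulerianAt x) :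
    cost0 N (fun x => translate (ρ x) (h x)) = cost0 N ρ := by
  have := sum_cap_mul_sub N h hh
  simp only [cost0, D0_translate]
  rw [← sub_eq_zero, ← Finset.sum_sub_distrib, ← this]
  exact Finset.sum_congr rfl fun e _ => by ring

lemma cost0_mono (N : Network S V) {ρ ρ' : V → Pt S}
    (h : ∀ x y, D0 (ρ' x) (ρ' y) ≤ D0 (ρ x) (ρ y)) : cost0 N ρ' ≤ cost0 N ρ :=
  Finset.sum_le_sum fun _ _ => mul_le_mul_of_nonneg_left (h _ _) (Nat.cast_nonneg _)

lemma FLPCost_eq_cost0 [Finite S] [Nonempty S] {R : Set (Pt S)} (hR : IsBalanced R)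
    (N : Network S V) {ρ : V → Pt S} (hρ : ∀ x, ρ x ∈ R) : FLPCost N ρ = cost0 N ρ :=
  Finset.sum_congr rfl fun e _ => by rw [Dinf_eq_D0 hR (hρ _) (hρ _)]

/-- Nonnegative feasible locations, up to cost and total size. -/
def feasibleSet [Fintype S] [Fintype V] (μ : S → S → ℝ) (N : Network S V) (c σ : ℝ) :
    Set (V → Pt S) :=
  {ρ | (∀ x, ρ x ∈ P μ) ∧ (∀ x u, 0 ≤ ρ x u) ∧ (∀ s, s ∈ zeroSet (ρ (N.terminal s))) ∧
    cost0 N ρ ≤ c ∧ ∑ x, ∑ u, ρ x u ≤ σ}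

lemma isCompact_feasibleSet [Fintype S] [Nonempty S] [Fintype V] (μ : S → S → ℝ) (N : Network S V)
    (c σ : ℝ) : IsCompact (feasibleSet μ N c σ) := by
  have hP : IsClosed (P μ) := by
    simp only [P, Set.ofPred_forall]
    exact isClosed_iInter fun s => isClosed_iInter fun t => isClosed_le (by fun_prop) (by fun_prop)
  have hcl : IsClosed (feasibleSet μ N c σ) := by
    simp only [feasibleSet, zeroSet, Set.mem_ofPred_eq, Set.ofPred_and, Set.ofPred_forall]
    refine IsClosed.inter ?_ (IsClosed.inter ?_ (IsClosed.inter ?_ (IsClosed.inter ?_ ?_)))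
    · exact isClosed_iInter fun x => hP.preimage (continuous_apply x)
    · exact isClosed_iInter fun x => isClosed_iInter fun u =>
        isClosed_le continuous_const (continuous_apply_apply x u)
    · exact isClosed_iInter fun s => isClosed_eq (by fun_prop) (by fun_prop)
    · refine isClosed_le ?_ continuous_const
      unfold cost0
      refine continuous_finsetSum _ fun e _ => continuous_const.mul ?_
      exact continuous_D0.comp (f := fun ρ : V → Pt S => (ρ e.1.1, ρ e.1.2)) (by fun_prop)
    · exact isClosed_le (by fun_prop) continuous_const
  refine (isCompact_Icc (a := (0 : V → Pt S)) (b := fun _ _ => σ)).of_isClosed_subset hcl ?_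
  rintro ρ ⟨-, h0, -, -, hσ⟩
  refine ⟨h0, fun x u => le_trans ?_ hσ⟩
  calc ρ x u ≤ ∑ u, ρ x u :=
        Finset.single_le_sum (f := fun u => ρ x u) (fun u _ => h0 x u) (Finset.mem_univ u)
    _ ≤ _ := Finset.single_le_sum (f := fun x => ∑ u, ρ x u)
        (fun x _ => Finset.sum_nonneg fun u _ => h0 x u) (Finset.mem_univ x)

/-! ### Moving a nonnegative location into the slim part -/

lemma eq_zero_of_mem_zeroSet {p : Pt S} (hp : ∀ u, 0 ≤ p u) {s : S} (hs : s ∈ zeroSet p) :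
    p (Sum.inl s) = 0 ∧ p (Sum.inr s) = 0 := by
  have h1 := hp (Sum.inl s)
  have h2 := hp (Sum.inr s)
  have h3 : p (Sum.inl s) + p (Sum.inr s) = 0 := hs
  constructor <;> linarith

lemma nonneg_of_eq_zero {μ : S → S → ℝ} (hμ : IsDirectedDistance μ) {p : Pt S} (hp : p ∈ P μ)
    {s : S} (h1 : p (Sum.inl s) = 0) (h2 : p (Sum.inr s) = 0) (u : S ⊕ S) : 0 ≤ p u := by
  rcases u with t | t
  · have := hp t s
    have := hμ.1 t s
    linarith
  · have := hp s t
    have := hμ.1 s t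
    linarith

lemma zeroSet_translate (p : Pt S) (h : ℝ) : zeroSet (translate p h) = zeroSet p := by
  ext s
  simp [zeroSet]

/-- In a properly inner Eulerian network, a nonnegative location can be moved into `Qslim μ` without
increasing the signed cost. -/
lemma exists_slim_location [Fintype S] [Nonempty S] [Fintype V] {μ : S → S → ℝ}
    (hμ : IsDirectedDistance μ) {N : Network S V} (hN : N.ProperlyInnerEulerian μ) {ρ₀ : V → Pt S}
    (h₀ : ∀ x, ρ₀ x ∈ P μ) (h₀' : ∀ x u, 0 ≤ ρ₀ x u)
    (h₀t : ∀ s, s ∈ zeroSet (ρ₀ (N.terminal s))) :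
    ∃ ρ : V → Pt S, (∀ x, ρ x ∈ Qslim μ) ∧ (∀ x u, 0 ≤ ρ x u) ∧
      (∀ s, s ∈ zeroSet (ρ (N.terminal s))) ∧ cost0 N ρ ≤ cost0 N ρ₀ := by
  obtain ⟨ρ, ⟨hP, hpos, hterm, hcost, hσ⟩, hmin⟩ :=
    (isCompact_feasibleSet μ N (cost0 N ρ₀) (∑ x, ∑ u, ρ₀ x u)).exists_isMinOn
      ⟨ρ₀, h₀, h₀', h₀t, le_rfl, le_rfl⟩ (f := fun ρ => ∑ x, ∑ u, ρ x u) (by fun_prop)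
  -- No admissible modification lowers the coordinate sum of any point: normalizing makes it a
  -- competitor of the minimizer ρ with the same sums.
  have himp : ∀ ρ' : V → Pt S, (∀ x, ρ' x ∈ P μ) → (∀ x y, D0 (ρ' x) (ρ' y) ≤ D0 (ρ x) (ρ y)) →
      (∀ s, s ∈ zeroSet (ρ' (N.terminal s))) →
      (∀ s, IsProperTerminal μ s → ρ' (N.terminal s) (Sum.inl s) = 0) →
      (∀ x, ∑ u, ρ' x u ≤ ∑ u, ρ x u) → ∀ x, ∑ u, ρ' x u = ∑ u, ρ x u := by
    intro ρ' hP' hD ht hprop hle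
    have hsum : ∑ x, ∑ u, normalize (ρ' x) u = ∑ x, ∑ u, ρ' x u :=
      Finset.sum_congr rfl fun x _ => sum_translate _ _
    have hcost' : cost0 N (fun x => normalize (ρ' x)) = cost0 N ρ' := by
      refine cost0_translate N ρ' (fun x => -⨅ s, ρ' x (Sum.inl s)) fun x => ?_
      by_cases hx : ∃ s, N.terminal s = x ∧ IsProperTerminal μ s
      · obtain ⟨s, rfl, hs⟩ := hx
        left
        have h1 := hprop s hs
        have h2 : ρ' (N.terminal s) (Sum.inl s) + ρ' (N.terminal s) (Sum.inr s) = 0 := ht s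
        -- Here both coordinates of s vanish, so all coordinates are nonnegative and the normalizing
        -- shift at this proper terminal is zero.
        rw [iInf_inl_eq_zero (fun t => nonneg_of_eq_zero hμ (hP' _) h1 (by linarith) _) h1, neg_zero]
      · exact Or.inr (hN x hx)
    have hmem : (fun x => normalize (ρ' x)) ∈
        feasibleSet μ N (cost0 N ρ₀) (∑ x, ∑ u, ρ₀ x u) := by
      refine ⟨fun x => translate_mem_P (hP' x) _, fun x u => normalize_nonneg hμ (hP' x) u,
        fun s => ?_, ?_, ?_⟩
      · simp only [normalize, zeroSet_translate]
        exact ht s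
      · rw [hcost']
        exact (cost0_mono N hD).trans hcost
      · rw [hsum]
        exact (Finset.sum_le_sum fun x _ => hle x).trans hσ
    have h1 : ∑ x, ∑ u, ρ x u ≤ ∑ x, ∑ u, normalize (ρ' x) u := hmin hmem
    rw [hsum] at h1
    have h2 := (Finset.sum_eq_sum_iff_of_le fun x _ => hle x).1
      (le_antisymm (Finset.sum_le_sum fun x _ => hle x) h1)
    exact fun x => h2 x (Finset.mem_univ x)
  have hQ : ∀ x, ρ x ∈ Q μ := by
    have hterm' : ∀ s, s ∈ zeroSet (contract μ (ρ (N.terminal s))) ∧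
        contract μ (ρ (N.terminal s)) (Sum.inl s) = 0 := by
      intro s
      obtain ⟨h1, h2⟩ := eq_zero_of_mem_zeroSet (hpos _) (hterm s)
      have h3 := contract_le (hP (N.terminal s)) (Sum.inl s)
      have h4 := contract_le (hP (N.terminal s)) (Sum.inr s)
      have h5 := contract_mem_P μ (ρ (N.terminal s)) s s
      rw [hμ.2] at h5
      rw [zeroSet, Set.mem_ofPred_eq]
      constructor <;> linarith
    have := himp (fun x => contract μ (ρ x)) (fun x => contract_mem_P μ _)
      (fun x y => D0_contract_le μ _ _) (fun s => (hterm' s).1) (fun s _ => (hterm' s).2)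
      (fun x => Finset.sum_le_sum fun u _ => contract_le (hP x) u)
    intro x
    refine mem_Q_of_contract_eq (funext fun u => ?_)
    exact (Finset.sum_eq_sum_iff_of_le fun u _ => contract_le (hP x) u).1 (this x) u
      (Finset.mem_univ u)
  refine ⟨ρ, fun x => ⟨hQ x, fun hx => ?_⟩, hpos, hterm, hcost⟩
  obtain ⟨ρ', h1, h2, h3, h4, h5, h6⟩ := exists_improvement_of_isProperFat hμ ρ hQ hx
  refine h6.ne (himp ρ' (fun x => (h1 x).1) h2 (fun s => ?_) (fun s hs => ?_) h5 x)
  · rw [h3]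
    exact hterm s
  -- The point at a proper terminal is no fat, so it has not moved.
  · rw [h4 _ (hs _ ⟨hQ _, hterm s⟩)]
    exact (eq_zero_of_mem_zeroSet (hpos _) (hterm s)).1

/-! ### Representatives in a slimmed section -/

/-- `r` arises from `p` by translating by `h` and, if `p` and `r` are degenerate, moving along
`vec X`. -/
def Represents (μ : S → S → ℝ) (p r : Pt S) (h : ℝ) : Prop :=
  r = translate p h ∨ ∃ X : Set S, X.Nonempty ∧ Xᶜ.Nonempty ∧ X ∈ zeroSets μ ∧ p ∈ Qdeg μ X ∧
    r ∈ Qdeg μ X ∧ ∀ s ∉ X, r (Sum.inl s) = p (Sum.inl s) + h ∧ r (Sum.inr s) = p (Sum.inr s) - h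

lemma exists_represents_of_slimRel {μ : S → S → ℝ} {p r : Pt S} (h : SlimRel μ r p) :
    ∃ h, Represents μ p r h := by
  rcases h with h | ⟨X, hX, hr, hp, h⟩
  · obtain ⟨a, rfl⟩ := sub_mem_line_iff.1 h
    exact ⟨a, Or.inl rfl⟩
  · obtain ⟨y, hy, z, hz, hyz⟩ := Submodule.mem_sup.1 h
    obtain ⟨a, rfl⟩ := Submodule.mem_span_singleton.1 hy
    obtain ⟨b, rfl⟩ := Submodule.mem_span_singleton.1 hz
    have hval : ∀ u, r u = p u + a * vec Set.univ u + b * vec X u := fun u => by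
      have := congrFun hyz u
      simp only [Pi.add_apply, Pi.smul_apply, Pi.sub_apply, smul_eq_mul] at this
      linarith
    -- For X empty or all of S, moving along `vec X` is itself a translation; this leaves only
    -- proper nonempty X for the second alternative.
    rcases X.eq_empty_or_nonempty with rfl | hX1
    · refine ⟨a, Or.inl ?_⟩
      funext u
      rw [hval]
      rcases u with s | s
      · simp [vec]
      · simp [vec]
        ring
    rcases Xᶜ.eq_empty_or_nonempty with hX2 | hX2
    · rw [Set.compl_empty_iff] at hX2
      subst hX2
      refine ⟨a + b, Or.inl ?_⟩
      funext u
      rw [hval]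
      rcases u with s | s <;> (simp [vec]; ring)
    · refine ⟨a, Or.inr ⟨X, hX1, hX2, hX, hp, hr, fun s hs => ⟨?_, ?_⟩⟩⟩
      · simp [hval, vec, hs]
      · simp [hval, vec, hs]
        ring

lemma translate_mem_Qdeg {μ : S → S → ℝ} {p : Pt S} {h : ℝ} {X : Set S}
    (hr : translate p h ∈ Q μ) : translate p h ∈ Qdeg μ X ↔ p ∈ Qdeg μ X := by
  have hmem : translate p h - p ∈ line S := sub_mem_line_iff.2 ⟨h, rfl⟩
  refine ⟨fun hd => ?_, fun hd => Qdeg_of_sub_mem_line μ hr hmem hd⟩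
  refine Qdeg_of_sub_mem_line μ ⟨?_, ?_⟩ (sub_mem_symm hmem) hd
  · intro s t
    have := hr.1 s t
    simpa using this
  · intro q hq hqp u
    have := hr.2 (translate_mem_P hq h) (by
      rintro (s | s)
      · simpa using hqp (Sum.inl s)
      · simpa using hqp (Sum.inr s)) u
    rcases u with s | s <;> simpa using this

variable [Finite S] [Nonempty S]

omit [Finite S] [Nonempty S] in
lemma Represents.mem_Qdeg {μ : S → S → ℝ} (hμ : IsDirectedDistance μ) {p r : Pt S} {h : ℝ}
    (hr : Represents μ p r h) (hrQ : r ∈ Q μ) {X : Set S} : p ∈ Qdeg μ X ↔ r ∈ Qdeg μ X := by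
  rcases hr with rfl | ⟨Y, -, -, -, hp, hr, -⟩
  · exact (translate_mem_Qdeg hrQ).symm
  · have key : ∀ q : Pt S, q ∈ Qdeg μ Y → (q ∈ Qdeg μ X ↔ X = Y) := fun q hq => by
      refine ⟨fun h => ?_, fun h => h ▸ hq⟩
      rw [((mem_Qdeg_iff hμ).1 hq).2.1, ((mem_Qdeg_iff hμ).1 h).2.1]
    rw [key p hp, key r hr]

omit [Finite S] [Nonempty S] in
lemma Represents.coord {μ : S → S → ℝ} (hμ : IsDirectedDistance μ) {p r : Pt S} {h : ℝ}
    (hr : Represents μ p r h) {X : Set S} (hX : r ∈ Qdeg μ X) {s : S} (hs : s ∉ X) :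
    r (Sum.inl s) = p (Sum.inl s) + h ∧ r (Sum.inr s) = p (Sum.inr s) - h := by
  rcases hr with rfl | ⟨Y, -, -, -, -, hr, hY⟩
  · simp
  · refine hY s ?_
    rwa [((mem_Qdeg_iff hμ).1 hr).2.1, ← ((mem_Qdeg_iff hμ).1 hX).2.1]

omit [Finite S] [Nonempty S] in
lemma Represents.zeroSet_eq {μ : S → S → ℝ} (hμ : IsDirectedDistance μ) {p r : Pt S} {h : ℝ}
    (hr : Represents μ p r h) : zeroSet r = zeroSet p := by
  rcases hr with rfl | ⟨Y, -, -, -, hp, hr, -⟩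
  · exact zeroSet_translate p h
  · rw [← ((mem_Qdeg_iff hμ).1 hp).2.1, ← ((mem_Qdeg_iff hμ).1 hr).2.1]

/-- Replacing the first point by a representative. -/
lemma Represents.D0_left_le {μ : S → S → ℝ} (hμ : IsDirectedDistance μ) {p r q : Pt S} {h : ℝ}
    (hr : Represents μ p r h) (hq : q ∈ Qslim μ)
    (hn : r = translate p h ∨ q ∉ Qdeg μ (zeroSet r)) : D0 r q ≤ D0 p q - h := by
  by_cases htr : r = translate p h
  · have := D0_translate p q h 0
    rw [translate_zero] at this
    rw [htr]
    linarith
  · obtain ⟨X, -, -, -, -, hX, hc⟩ := hr.resolve_left htr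
    obtain ⟨hrQ, rfl, -⟩ := (mem_Qdeg_iff hμ).1 hX
    refine D0_le_of_inr hrQ.1 hq.1
      (sub_inr_le_of_notMem_Qdeg hμ hrQ.1 hq (hn.resolve_left htr) fun t ht => ?_)
    rw [(hc t ht).2]
    linarith [sub_inr_le_D0 p q t]

/-- Replacing the second point by a representative. -/
lemma Represents.D0_right_le {μ : S → S → ℝ} (hμ : IsDirectedDistance μ) {p r q : Pt S} {h : ℝ}
    (hr : Represents μ p r h) (hq : q ∈ Qslim μ)
    (hn : r = translate p h ∨ q ∉ Qdeg μ (zeroSet r)) : D0 q r ≤ D0 q p + h := by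
  by_cases htr : r = translate p h
  · have := D0_translate q p 0 h
    rw [translate_zero] at this
    rw [htr]
    linarith
  · obtain ⟨X, -, -, -, -, hX, hc⟩ := hr.resolve_left htr
    obtain ⟨hrQ, rfl, -⟩ := (mem_Qdeg_iff hμ).1 hX
    refine D0_le_of_inl hq.1 hrQ.1
      (sub_inl_le_of_notMem_Qdeg hμ hrQ.1 hq (hn.resolve_left htr) fun t ht => ?_)
    rw [(hc t ht).1]
    linarith [sub_inl_le_D0 q p t]

/-- If r and r' share a degenerate set with X proper and nonempty, both vanish on X by
nonnegativity, and outside X their coordinates are shifted from those of p and q. Otherwise the two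
points can be replaced one at a time. -/
lemma Represents.D0_le {μ : S → S → ℝ} (hμ : IsDirectedDistance μ) {R : Set (Pt S)}
    (hR : IsNonnegSlimmedSection μ R) {p q r r' : Pt S} {h k : ℝ} (hp : p ∈ Qslim μ)
    (hpr : Represents μ p r h) (hqr : Represents μ q r' k)
    (hr : r ∈ R) (hr' : r' ∈ R) : D0 r r' ≤ D0 p q + k - h := by
  obtain ⟨hRpos, -, -, hslim⟩ := hR
  have hrs := (hRpos hr).1
  have hrs' := (hRpos hr').1
  by_cases hX : ∃ X : Set S, X.Nonempty ∧ Xᶜ.Nonempty ∧ X ∈ zeroSets μ ∧ r ∈ Qdeg μ X ∧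
      r' ∈ Qdeg μ X
  · obtain ⟨X, -, ⟨s₀, hs₀⟩, hX0, hrX, hrX'⟩ := hX
    have hzr := ((mem_Qdeg_iff hμ).1 hrX).2.1
    have hzr' := ((mem_Qdeg_iff hμ).1 hrX').2.1
    have hout : ∀ s ∉ X, r' (Sum.inl s) - r (Sum.inl s) ≤ D0 p q + k - h ∧
        r (Sum.inr s) - r' (Sum.inr s) ≤ D0 p q + k - h := by
      intro s hs
      obtain ⟨h1, h2⟩ := hpr.coord hμ hrX hs
      obtain ⟨h3, h4⟩ := hqr.coord hμ hrX' hs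
      have := sub_inl_le_D0 p q s
      have := sub_inr_le_D0 p q s
      constructor <;> linarith
    -- Slimness gives a coordinate outside X where r' is at least r; nonnegativity of the bound is
    -- what the vanishing coordinates on X need.
    have hd : 0 ≤ D0 p q + k - h := by
      by_cases hne : r' = r
      · subst hne
        simpa using (hout s₀ hs₀).1
      · have := hslim X hX0 r' ⟨hr', hrX', (hRpos hr').2⟩ r ⟨hr, hrX, (hRpos hr).2⟩ hne
        push Not at this
        obtain ⟨⟨s, hs, hle⟩, -⟩ := this
        linarith [(hout s hs).1]
    have hin : ∀ s ∈ X, r' (Sum.inl s) - r (Sum.inl s) ≤ D0 p q + k - h ∧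
        r (Sum.inr s) - r' (Sum.inr s) ≤ D0 p q + k - h := by
      intro s hs
      obtain ⟨h1, h2⟩ := eq_zero_of_mem_zeroSet (hRpos hr).2 (hzr ▸ hs)
      obtain ⟨h3, h4⟩ := eq_zero_of_mem_zeroSet (hRpos hr').2 (hzr' ▸ hs)
      constructor <;> linarith
    refine DirectedMultiflow.D0_le (fun s => ?_) (fun s => ?_) <;> by_cases hs : s ∈ X
    exacts [(hin s hs).1, (hout s hs).1, (hin s hs).2, (hout s hs).2]
  · have h1 : D0 r r' ≤ D0 p r' - h := by
      refine hpr.D0_left_le hμ hrs' ?_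
      by_contra! hn
      obtain ⟨X, h1, h2, h3, h4, h5, -⟩ := hpr.resolve_left hn.1
      have hz := ((mem_Qdeg_iff hμ).1 h5).2.1
      exact hX ⟨X, h1, h2, h3, h5, hz ▸ hn.2⟩
    have h2 : D0 p r' ≤ D0 p q + k := by
      refine hqr.D0_right_le hμ hp ?_
      by_contra! hn
      obtain ⟨X, h1, h2, h3, h4, h5, -⟩ := hqr.resolve_left hn.1
      have hz := ((mem_Qdeg_iff hμ).1 h5).2.1
      exact hX ⟨X, h1, h2, h3, (hpr.mem_Qdeg hμ hrs.1).1 (hz ▸ hn.2), h5⟩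
    linarith

omit [Finite S] [Nonempty S] in
lemma exists_represents {μ : S → S → ℝ} {R : Set (Pt S)} (hR : IsSlimSection μ R) {p : Pt S}
    (hp : p ∈ Qslim μ) : ∃ r ∈ R, ∃ h, Represents μ p r h := by
  obtain ⟨r, hr, hrp⟩ := hR.2.surjOn
    (Set.mem_univ (Quotient.mk (slimSetoid μ) ⟨p, hp⟩ : SlimmedTropicalPolytope μ))
  exact ⟨r.1, hr, exists_represents_of_slimRel (Quotient.exact hrp)⟩

/-! ### The two duality theorems -/

omit [Nonempty S] in
-- Nonnegativity makes both coordinates of a terminal vanish at its own point. So the source's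
-- column coordinate starts at 0 and, by the inequality of `P μ`, is at least μ at the target.
lemma isMFPOpt_le_FLPCost {μ : S → S → ℝ} {R : Set (Pt S)} (hR : IsNonnegSlimmedSection μ R)
    {N : Network S V} {v : ℝ} (hv : IsMFPOpt μ N v) {ρ : V → Pt S} (hρ : FLPFeasible R N ρ) :
    v ≤ FLPCost N ρ := by
  obtain ⟨f, rfl⟩ := hv.1
  refine f.val_le (fun e => Dinf (ρ e.1.1) (ρ e.1.2)) (fun e => Dinf_nonneg _ _) fun Pa => ?_
  have h1 := sub_le_sum_of_isChain N (fun e => Dinf (ρ e.1.1) (ρ e.1.2)) (fun e => Dinf_nonneg _ _)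
    (fun x => ρ x (Sum.inl Pa.source)) (fun e => sub_inl_le_Dinf _ _ _) Pa.nodes _ _ Pa.nodup
    Pa.chain Pa.head_eq Pa.last_eq
  have h2 : ∀ s, s ∈ zeroSet (ρ (N.terminal s)) := fun s => (hρ.2 s).2
  have h3 := (eq_zero_of_mem_zeroSet (hR.1 (hρ.1 _)).2 (h2 Pa.source)).1
  have h4 := (eq_zero_of_mem_zeroSet (hR.1 (hρ.1 _)).2 (h2 Pa.target)).2
  have h5 := (hR.1 (hρ.1 (N.terminal Pa.target))).1.1.1 Pa.source Pa.target
  refine le_trans ?_ (h1.trans_eq (by unfold SPath.Uses; congr!))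
  linarith

/-- An optimal edge length gives a nonnegative location. -/
lemma exists_location {μ : S → S → ℝ} (hμ : IsDirectedDistance μ) {N : Network S V}
    {w : N.edges → ℝ} (hw : ∀ e, 0 ≤ w e)
    (hp : open Classical in
      ∀ p : SPath N, μ p.source p.target ≤ ∑ e : N.edges with p.Uses e.1, w e) :
    ∃ ρ : V → Pt S, (∀ x, ρ x ∈ P μ) ∧ (∀ x u, 0 ≤ ρ x u) ∧
      (∀ s, s ∈ zeroSet (ρ (N.terminal s))) ∧ cost0 N ρ ≤ ∑ e, (N.cap e : ℝ) * w e := by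
  classical
  have := Fintype.ofFinite S
  -- M dominates all values of μ, so truncation preserves the inequalities of `P μ`; for unreachable
  -- pairs the untruncated infimum would default to 0.
  set M : ℝ := ∑ s, ∑ t, μ s t with hMdef
  have hM : 0 ≤ M := Finset.sum_nonneg fun s _ => Finset.sum_nonneg fun t _ => hμ.1 s t
  have hMle : ∀ s t, μ s t ≤ M := fun s t =>
    (Finset.single_le_sum (f := fun t => μ s t) (fun t _ => hμ.1 s t) (Finset.mem_univ t)).trans
      (Finset.single_le_sum (f := fun s => ∑ t, μ s t)
        (fun s _ => Finset.sum_nonneg fun t _ => hμ.1 s t) (Finset.mem_univ s))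
  have hwalk : ∀ s t r, WalkLength N w (N.terminal s) (N.terminal t) r → μ s t ≤ r := by
    intro s t r h
    by_cases hst : s = t
    · subst hst
      rw [hμ.2]
      exact h.nonneg hw
    · obtain ⟨l, h1, h2, h3, h4, h5⟩ := h.exists_path hw
      exact (hp ⟨l, s, t, hst, h1, h2, h3, h4⟩).trans
        (le_trans (by unfold SPath.Uses; exact le_of_eq (by congr!)) h5)
  refine ⟨fun x => Sum.elim (fun s => truncDist N w M (N.terminal s) x)
    (fun s => truncDist N w M x (N.terminal s)), fun x s t => ?_, ?_, fun s => ?_, ?_⟩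
  · simp only [Sum.elim_inl, Sum.elim_inr]
    have h0 := truncDist_nonneg hw hM (N.terminal s) x
    have h0' := truncDist_nonneg hw hM x (N.terminal t)
    rw [← sub_le_iff_le_add]
    refine le_truncDist (by linarith [hMle s t]) fun r hr => ?_
    rw [sub_le_iff_le_add, ← sub_le_iff_le_add']
    refine le_truncDist (by linarith [hMle s t, hr.nonneg hw]) fun r' hr' => ?_
    linarith [hwalk s t _ (hr.trans hr')]
  · rintro x (s | s)
    exacts [truncDist_nonneg hw hM _ _, truncDist_nonneg hw hM _ _]
  · simp [zeroSet, truncDist_self hw hM]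
  · refine Finset.sum_le_sum fun e _ => mul_le_mul_of_nonneg_left ?_ (Nat.cast_nonneg _)
    exact D0_le (fun s => truncDist_le_add_edge hw hM _ e) fun s => truncDist_le_edge_add hw hM _ e

lemma exists_opt_of_properlyInnerEulerian [Finite V] {μ : S → S → ℝ} (hμ : IsDirectedDistance μ)
    {N : Network S V} (hN : N.ProperlyInnerEulerian μ) {R : Set (Pt S)}
    (hR : IsNonnegSlimmedSection μ R) : ∃ v : ℝ, IsMFPOpt μ N v ∧ IsFLPOpt R N v := by
  have := Fintype.ofFinite S
  have := Fintype.ofFinite V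
  obtain ⟨v, hv, w, hw0, hwP, hwv⟩ := exists_isMFPOpt μ N
  obtain ⟨ρ₀, a1, a2, a3, a4⟩ := exists_location hμ hw0 hwP
  obtain ⟨ρ, b1, b2, b3, b4⟩ := exists_slim_location hμ hN a1 a2 a3
  choose r hr h hh using fun x => exists_represents hR.2.1 (b1 x)
  have hterm : ∀ s, s ∈ zeroSet (r (N.terminal s)) := fun s => by
    rw [(hh _).zeroSet_eq hμ]
    exact b3 s
  have hfeas : FLPFeasible R N r := ⟨hr, fun s => ⟨hr _, hterm s⟩⟩
  -- At a proper terminal the point is no fat, so its representative is a pure translate; both have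
  -- column coordinate zero at s, so the shift is zero.
  have hzero : ∀ x, h x = 0 ∨ N.EulerianAt x := by
    intro x
    by_cases hx : ∃ s, N.terminal s = x ∧ IsProperTerminal μ s
    · obtain ⟨s, rfl, hs⟩ := hx
      left
      have h1 : r (N.terminal s) = translate (ρ (N.terminal s)) (h (N.terminal s)) := by
        refine (hh (N.terminal s)).resolve_right ?_
        rintro ⟨X, -, -, -, hX, -, -⟩
        refine hs _ ⟨(b1 _).1, b3 s⟩ ((isFat_iff hμ).2 ⟨(b1 _).1, ?_⟩)
        exact ((mem_Qdeg_iff hμ).1 hX).2.2.imp And.left And.left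
      have h2 := (eq_zero_of_mem_zeroSet (b2 _) (b3 s)).1
      have h3 := (eq_zero_of_mem_zeroSet (hR.1 (hr _)).2 (hterm s)).1
      rw [h1, translate_inl, h2, zero_add] at h3
      exact h3
    · exact Or.inr (hN x hx)
  have hcost : FLPCost N r ≤ v := by
    refine le_trans ?_ (b4.trans (a4.trans hwv))
    rw [FLPCost_eq_cost0 hR.2.2.1 N hr]
    have h1 : cost0 N r ≤ ∑ e : N.edges, ((N.cap e : ℝ) * D0 (ρ e.1.1) (ρ e.1.2) +
        (N.cap e : ℝ) * (h e.1.2 - h e.1.1)) := by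
      refine Finset.sum_le_sum fun e _ => ?_
      rw [← mul_add]
      refine mul_le_mul_of_nonneg_left ?_ (Nat.cast_nonneg _)
      have := Represents.D0_le hμ hR (b1 _) (hh e.1.1) (hh e.1.2) (hr _) (hr _)
      linarith
    rwa [Finset.sum_add_distrib, sum_cap_mul_sub N h hzero, add_zero] at h1
  refine ⟨v, hv, ⟨r, hfeas, (hcost.antisymm (isMFPOpt_le_FLPCost hR hv hfeas)).symm⟩, ?_⟩
  rintro _ ⟨ρ', hρ', rfl⟩
  exact isMFPOpt_le_FLPCost hR hv hρ'

/-- In a totally Eulerian network, locations in balanced sets that agree modulo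
translations have the same costs. -/
lemma exists_feasible_of_image_mkQ_subset [Finite V] {N : Network S V} (hN : N.TotallyEulerian)
    {R R' : Set (Pt S)} (hR : IsBalanced R) (hR' : IsBalanced R')
    (h : (line S).mkQ '' R ⊆ (line S).mkQ '' R') {ρ : V → Pt S} (hρ : FLPFeasible R N ρ) :
    ∃ ρ', FLPFeasible R' N ρ' ∧ FLPCost N ρ' = FLPCost N ρ := by
  have key : ∀ x, ∃ q ∈ R', ∃ a : ℝ, q = translate (ρ x) a := by
    intro x
    obtain ⟨q, hq, hqx⟩ := h ⟨_, hρ.1 x, rfl⟩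
    rw [Submodule.mkQ_apply, Submodule.mkQ_apply, Submodule.Quotient.eq] at hqx
    exact ⟨q, hq, sub_mem_line_iff.1 hqx⟩
  choose ρ' hρ' a ha using key
  refine ⟨ρ', ⟨hρ', fun s => ⟨hρ' _, ?_⟩⟩, ?_⟩
  · have := (hρ.2 s).2
    simp only [ha, translate_inl, translate_inr]
    linarith
  · rw [FLPCost_eq_cost0 hR N hρ.1, FLPCost_eq_cost0 hR' N hρ', funext ha]
    exact cost0_translate N ρ a fun x => Or.inr (hN x)

lemma exists_opt_of_totallyEulerian [Finite V] {μ : S → S → ℝ} (hμ : IsDirectedDistance μ)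
    {N : Network S V} (hN : N.TotallyEulerian) {R : Set (Pt S)} (hR : IsSlimmedSection μ R) :
    ∃ v : ℝ, IsMFPOpt μ N v ∧ IsFLPOpt R N v := by
  obtain ⟨-, hbal, R', hR', hRR'⟩ := hR
  obtain ⟨v, hv, ⟨ρ, hρ, hvρ⟩, hmin⟩ :=
    exists_opt_of_properlyInnerEulerian hμ (fun x _ => hN x) hR'
  refine ⟨v, hv, ?_, ?_⟩
  · obtain ⟨ρ', h1, h2⟩ := exists_feasible_of_image_mkQ_subset hN hR'.2.2.1 hbal hRR'.ge hρ
    exact ⟨ρ', h1, hvρ.trans h2.symm⟩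
  · rintro _ ⟨ρ', hρ', rfl⟩
    obtain ⟨ρ'', h1, h2⟩ := exists_feasible_of_image_mkQ_subset hN hbal hR'.2.2.1 hRR'.le hρ'
    rw [← h2]
    exact hmin ⟨ρ'', h1, rfl⟩

end Location

/-- Without terminals both optimal values are zero. -/
lemma exists_opt_of_isEmpty {S V : Type*} [IsEmpty S] (μ : S → S → ℝ) (N : Network S V)
    {R : Set (Pt S)} (hR : IsSlimSection μ R) : ∃ v : ℝ, IsMFPOpt μ N v ∧ IsFLPOpt R N v := by
  have hP : ∀ f : Multiflow N, f.val μ = 0 := fun f =>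
    Finset.sum_eq_zero fun p _ => isEmptyElim p.source
  have hD : ∀ p q : Pt S, Dinf p q = 0 := fun p q => by simp [Dinf, DinfPlus]
  have hC : ∀ ρ : V → Pt S, FLPCost N ρ = 0 := fun ρ => by simp [FLPCost, hD]
  -- The only point is degenerate for X = ∅, hence not a proper fat; so the section R is nonempty
  -- and a location exists.
  have hslim : (0 : Pt S) ∈ Qslim μ := by
    refine ⟨⟨fun s => isEmptyElim s, fun q _ _ u => isEmptyElim u⟩, fun h => h.2 ∅ ?_ ?_⟩
    · exact fun s => isEmptyElim s
    · refine ⟨⟨⟨fun s => isEmptyElim s, fun q _ _ u => isEmptyElim u⟩, fun s => isEmptyElim s⟩,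
        Or.inl (Subsingleton.elim _ _)⟩
  obtain ⟨r, hr, -⟩ := hR.2.surjOn
    (Set.mem_univ (Quotient.mk (slimSetoid μ) ⟨0, hslim⟩ : SlimmedTropicalPolytope μ))
  refine ⟨0, ⟨⟨⟨∅, 0, by simp⟩, hP _⟩, ?_⟩,
    ⟨fun _ => r.1, ⟨fun _ => hr, fun s => isEmptyElim s⟩, (hC _).symm⟩, ?_⟩
  · rintro _ ⟨f, rfl⟩
    exact (hP f).le
  · rintro _ ⟨ρ, -, rfl⟩
    exact (hC ρ).ge

end DirectedMultiflow

open DirectedMultiflow in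
theorem mainTheorem2 {S V : Type*} [Finite S] [Finite V] (μ : S → S → ℝ)
    (hμ : IsDirectedDistance μ) (N : Network S V) :
    (∀ R : Set (Pt S), IsNonnegSlimmedSection μ R → N.ProperlyInnerEulerian μ →
      ∃ v : ℝ, IsMFPOpt μ N v ∧ IsFLPOpt R N v) ∧
    (∀ R : Set (Pt S), IsSlimmedSection μ R → N.TotallyEulerian →
      ∃ v : ℝ, IsMFPOpt μ N v ∧ IsFLPOpt R N v) := by
  rcases isEmpty_or_nonempty S with hS | hS
  · exact ⟨fun R hR _ => exists_opt_of_isEmpty μ N hR.2.1,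
      fun R hR _ => exists_opt_of_isEmpty μ N hR.1⟩
  · exact ⟨fun R hR hN => exists_opt_of_properlyInnerEulerian hμ hN hR,
      fun R hR hN => exists_opt_of_totallyEulerian hμ hN hR⟩
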